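/- Consider a finite set $\mathcal F$ of fog nodes, finite type sets $\mathcal Y_j$ and arbitrary non-empty action sets $\mathcal A_j$ ($j\in\mathcal F$), and finite sets $\mathcal U$ of physical states, $\Omega$ of observations and $Z$ of end-of-slot outcomes. If the physical state of a slot is $u$ and the action profile is $\boldsymbol a$, the next physical state has a given law $T(\cdot,\boldsymbol a,u)$, and node $i$ receives the reward $\varpi_i(u,\boldsymbol a)$. At the end of the slot node $i$ learns $\varphi_i(u)\in Z$ ($\varphi_i$ given; injective if physical states are disclosed at the end of the slot, constant if they are not). At the beginning of the next slot, in physical state $u'$, it receives an observation drawn from $\Theta_i(\cdot,a_i,u')$. Fix a node $i$ with bounded reward. The types $\boldsymbol y_{-i}$ of the other nodes are unknown to $i$ and constant in time; in physical state $u$ the other nodes jointly draw their actions (afresh in each slot) from a given discrete law $\sigma_i(\cdot\mid \boldsymbol y_{-i},u)$. Let $T'_i(u',a,u,\boldsymbol y_{-i})$ be the resulting probability of moving from $u$ to $u'$ and $\bar\varpi_i(u,a,\boldsymbol y_{-i})$ the resulting expected reward when $i$ plays $a$. Let $0\le\gamma<1$. (1) Let $u_0$ be an initial physical state, let $b''_0$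 be a prior on the types $\boldsymbol y_{-i}$, let the true types $\boldsymbol y^*_{-i}$ have positive prior probability, and let node $i$ choose its actions by any (randomized, history-dependent) rule. Along the realized physical states $u_t$ and own actions $a_t$, let the belief about types be updated by Bayes' rule $$b''_{t+1}(\boldsymbol y_{-i})=\frac{T'_i(u_{t+1},a_t,u_t,\boldsymbol y_{-i})\,b''_t(\boldsymbol y_{-i})}{\sum_{\boldsymbol y'_{-i}}T'_i(u_{t+1},a_t,u_t,\boldsymbol y'_{-i})\,b''_t(\boldsymbol y'_{-i})}.$$ Then, almost surely, $b''_t$ converges to a probability distribution $b''_\infty$, which is stationary: the Bayes update of $b''_\infty$ by the transition $(u_t,a_t,u_{t+1})$ tends to $b''_\infty$ as $t\to\infty$, and it equals $b''_\infty$ for each transition that occurs infinitely often. (2) Let $b$ denote beliefs of $i$ about the pair $(u,\boldsymbol y_{-i})$, written $b(u,\boldsymbol y_{-i})=b'(u)\,b''(\boldsymbol y_{-i}\mid u)$ and updated by Bayes' rule to $B(b,a,z,o)$ after own action $a$, outcome $z$ and next observation $o$. If $z=\varphi_i(u)$ discloses the past state $u$, then the type component of $B(b,a,z,o)$ under each state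 $u'$ of positive probability is obtained from $b''(\cdot\mid u)$ by the rule in (1), applied to the transition $(u,a,u')$. The Bellman equation $\upsilon(b)=\sup_{a}\bar\varpi'_i(b,a)$ with $$\bar\varpi'_i(b,a)=\sum_{u,\boldsymbol y_{-i}}b'(u)\,b''(\boldsymbol y_{-i}\mid u)\,\bar\varpi_i(u,a,\boldsymbol y_{-i})+\gamma\sum_{z,o}\Pr(z,o\mid b,a)\,\upsilon\big(B(b,a,z,o)\big)$$ has exactly one bounded solution $\upsilon$ on the set of beliefs. Every policy that takes, at each belief $b$, an action maximizing $\bar\varpi'_i(b,\cdot)$ (such a policy exists if $\mathcal A_i$ is finite) is optimal from every initial belief state $b_0$: if the initial physical state and the types are distributed according to $b_0$, its expected discounted reward $\sum_t\gamma^t\,\mathbb E[\varpi_{i,t}]$ equals $\upsilon(b_0)$ and is at least that of every history-dependent, possibly randomized (with discrete laws) policy based on what node $i$ has seen. -/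

import Mathlib

open Filter Topology MeasureTheory

noncomputable section

/-- Expectation of a real function under a discrete probability distribution. -/
def expect {α : Type*} (p : PMF α) (f : α → ℝ) : ℝ := ∑' x, (p x).toReal * f x

/-- The energy scheduling game with set of fog nodes `F`.  `Y j` is the type space and `A j` the
action set of node `j`, `U` the set of physical states, `O` the set of observations, and `Z` the
set of end-of-slot outcomes. -/
structure FogGame (F : Type*) (Y A : F → Type*) (U O Z : Type*) where
  /-- law of the next physical state, given the present one and the action profile -/
  transition : U → (∀ j, A j) → PMF U
  /-- law of the observation of node `i` at the beginning of a slot, given its previous action and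
  the new physical state -/
  observation : ∀ i : F, A i → U → PMF O
  /-- reward of node `i` in a slot with the given physical state and action profile -/
  reward : F → U → (∀ j, A j) → ℝ
  /-- what node `i` learns, at the end of a slot, about the physical state of this slot: nothing if
  the map is constant, the state itself if the map is injective -/
  outcome : F → U → Z
  /-- how the types of the nodes other than `i` determine the (joint) random decision of these
  nodes in a physical state -/
  decision : ∀ i : F, (∀ j : {j : F // j ≠ i}, Y j.1) → U → PMF (∀ j : {j : F // j ≠ i}, A j.1)

/-- The profiles of types of the nodes other than `i`. -/
abbrev OtherTypes {F : Type*} (Y : F → Type*) (i : F) : Type _ := ∀ j : {j : F // j ≠ i}, Y j.1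

namespace FogGame

variable {F : Type*} [DecidableEq F] {Y A : F → Type*} {U O Z : Type*}

/-- The action profile with action `a` of node `i` and actions `a'` of the others. -/
def profile (i : F) (a : A i) (a' : ∀ j : {j : F // j ≠ i}, A j.1) : ∀ j, A j :=
  (Equiv.piSplitAt i A).symm (a, a')

/-- Transition dynamics `T'ᵢ` of the B-POMDP of node `i`: law of the next physical state when node
`i` takes action `a` in the physical state `u` and the others, whose types are `y`, decide
according to their types. -/
def stateKernel (G : FogGame F Y A U O Z) (i : F) (y : OtherTypes Y i) (u : U) (a : A i) : PMF U :=
  (G.decision i y u).bind fun a' => G.transition u (profile i a a')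

/-- Expected reward of node `i` in one slot, given the physical state and the types of the
others. -/
def slotReward (G : FogGame F Y A U O Z) (i : F) (y : OtherTypes Y i) (u : U) (a : A i) : ℝ :=
  expect (G.decision i y u) fun a' => G.reward i u (profile i a a')

/-! ### Bayesian update of the belief about types -/

section TypeBelief

variable [Fintype F] [∀ j, Fintype (Y j)]

/-- Bayes' rule for the belief `b` about the types of the other nodes, after the transition of the
physical state from `u` to `u'` under own action `a`:
`b⁺ y = β' * T'ᵢ (u', a, u, y) * b y` with a normalizing factor `β'`. -/
def typeBeliefUpdate (G : FogGame F Y A U O Z) (i : F) (b : OtherTypes Y i → ℝ)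
    (u : U) (a : A i) (u' : U) : OtherTypes Y i → ℝ := fun y =>
  (G.stateKernel i y u a u').toReal * b y / ∑ y', (G.stateKernel i y' u a u').toReal * b y'

/-- The successive beliefs about types, started from `b`, along a path of physical states `u` and
own actions `a`. -/
def typeBeliefSeq (G : FogGame F Y A U O Z) (i : F) (b : OtherTypes Y i → ℝ)
    (u : ℕ → U) (a : ℕ → A i) : ℕ → OtherTypes Y i → ℝ
  | 0 => b
  | t + 1 => G.typeBeliefUpdate i (typeBeliefSeq G i b u a t) (u t) (a t) (u (t + 1))

end TypeBelief

/-! ### Law of the process -/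

/-- A rule by which the action of node `i` is drawn in each slot from the past (a list with the
most recent slot first; the entry of slot `s` is the physical state and own action in slot `s` and
the observation at the beginning of slot `s + 1`) and the present physical state.  It is not
restricted to the information that node `i` really has. -/
abbrev Behaviour (A : F → Type*) (U O : Type*) (i : F) : Type _ := List (U × A i × O) → U → PMF (A i)

/-- Law of (present physical state, types of the others, past) at the beginning of slot `t`, when
the initial physical state and the types of the others have joint law `init` and node `i` acts
according to `β`. -/
def runLaw (G : FogGame F Y A U O Z) (i : F) (β : Behaviour A U O i)
    (init : PMF (U × OtherTypes Y i)) : ℕ → PMF ((U × OtherTypes Y i) × List (U × A i × O))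
  | 0 => init.map fun s => (s, [])
  | t + 1 => (runLaw G i β init t).bind fun r =>
      (β r.2 r.1.1).bind fun a =>
        (G.stateKernel i r.1.2 r.1.1 a).bind fun u' =>
          (G.observation i a u').map fun o => ((u', r.1.2), (r.1.1, a, o) :: r.2)

/-- The past at the beginning of slot `t` along a path. -/
def past {i : F} (u : ℕ → U) (a : ℕ → A i) (o : ℕ → O) : ℕ → List (U × A i × O)
  | 0 => []
  | t + 1 => (u t, a t, o (t + 1)) :: past u a o t

/-- On the probability space `(S, P)`, the sequences `u`, `a`, `o` of physical states, actions and
observations of node `i` form a run of the game from the physical state `u₀`, when the true types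
of the others are `y` and node `i` acts according to `β`. -/
structure IsRun (G : FogGame F Y A U O Z) (i : F) (β : Behaviour A U O i) (u₀ : U)
    (y : OtherTypes Y i) {S : Type*} [mS : MeasurableSpace S] (P : Measure S)
    (u : ℕ → S → U) (a : ℕ → S → A i) (o : ℕ → S → O) : Prop where
  measurable_state : ∀ t, Measurable[mS, ⊤] (u t)
  measurable_action : ∀ t, Measurable[mS, ⊤] (a t)
  measurable_obs : ∀ t, Measurable[mS, ⊤] (o t)
  law : ∀ t w h,
    P {ω | u t ω = w ∧ past (fun s => u s ω) (fun s => a s ω) (fun s => o s ω) t = h} =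
      G.runLaw i β (PMF.pure (u₀, y)) t ((w, y), h)

/-- A policy of node `i`: its action is drawn on the basis of what it has seen, that is, of the
past slots (most recent first), each with the end-of-slot outcome, the own action, and the
observation at the beginning of the next slot. -/
abbrev Policy (A : F → Type*) (O Z : Type*) (i : F) : Type _ := List (Z × A i × O) → PMF (A i)

/-- The behaviour of a node that follows a policy. -/
def Policy.behaviour {i : F} (G : FogGame F Y A U O Z) (π : Policy A O Z i) : Behaviour A U O i :=
  fun h _ => π (h.map fun e => (G.outcome i e.1, e.2.1, e.2.2))

/-- Expected reward of node `i` in slot `t` under a policy, when the initial physical state and the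
types of the others have joint law `init`. -/
def meanReward (G : FogGame F Y A U O Z) (i : F) (π : Policy A O Z i)
    (init : PMF (U × OtherTypes Y i)) (t : ℕ) : ℝ :=
  expect
    ((G.runLaw i (π.behaviour G) init t).bind fun r =>
      (π.behaviour G r.2 r.1.1).bind fun a =>
        (G.decision i r.1.2 r.1.1).map fun a' => (r.1.1, profile i a a'))
    fun x => G.reward i x.1 x.2

/-- Long-term discounted expected reward of node `i`. -/
def longTermReward (G : FogGame F Y A U O Z) (i : F) (γ : ℝ) (π : Policy A O Z i)
    (init : PMF (U × OtherTypes Y i)) : ℝ :=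
  ∑' t : ℕ, γ ^ t * G.meanReward i π init t

/-! ### Belief states and the Bellman equation -/

section Belief

variable [Fintype F] [∀ j, Fintype (Y j)] [Fintype U] [Fintype O] [Fintype Z] {i : F}

/-- The belief `b'` about the physical state contained in a belief about state and types. -/
def stateBelief (b : U × OtherTypes Y i → ℝ) (u : U) : ℝ := ∑ y, b (u, y)

/-- The belief `b''` about the types of the others under the physical state `u`. -/
def typeBelief (b : U × OtherTypes Y i → ℝ) (u : U) (y : OtherTypes Y i) : ℝ :=
  b (u, y) / stateBelief b u

variable (G : FogGame F Y A U O Z)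

open Classical in
/-- Probability, under belief `b` and own action `a`, that the present slot ends with outcome `z`,
the next observation is `o`, the next physical state is `s.1` and the types of the others are
`s.2`. -/
def jointProb (b : U × OtherTypes Y i → ℝ) (a : A i) (z : Z) (o : O)
    (s : U × OtherTypes Y i) : ℝ :=
  (G.observation i a s.1 o).toReal *
    ∑ u, if G.outcome i u = z then (G.stateKernel i s.2 u a s.1).toReal * b (u, s.2) else 0

/-- Probability of outcome `z` and next observation `o` under belief `b` and own action `a`. -/
def signalProb (b : U × OtherTypes Y i → ℝ) (a : A i) (z : Z) (o : O) : ℝ :=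
  ∑ s, G.jointProb b a z o s

/-- Bayesian update of the belief about physical state and types. -/
def beliefUpdate (b : U × OtherTypes Y i → ℝ) (a : A i) (z : Z) (o : O) :
    U × OtherTypes Y i → ℝ := fun s => G.jointProb b a z o s / G.signalProb b a z o

/-- Long-term expected reward of action `a` under belief `b`, when `v` gives the future expected
reward as a function of the future belief. -/
def actionValue (γ : ℝ) (v : (U × OtherTypes Y i → ℝ) → ℝ) (b : U × OtherTypes Y i → ℝ)
    (a : A i) : ℝ :=
  ∑ u, ∑ y, stateBelief b u * typeBelief b u y * G.slotReward i y u a +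
    γ * ∑ z, ∑ o, G.signalProb b a z o * v (G.beliefUpdate b a z o)

/-- `v` is bounded and satisfies the Bellman equation on all beliefs. -/
def IsBellmanSolution (γ : ℝ) (v : (U × OtherTypes Y i → ℝ) → ℝ) : Prop :=
  (∃ C : ℝ, ∀ b ∈ stdSimplex ℝ (U × OtherTypes Y i), |v b| ≤ C) ∧
    ∀ b ∈ stdSimplex ℝ (U × OtherTypes Y i),
      IsLUB (Set.range fun a : A i => G.actionValue γ v b a) (v b)

/-- `d` selects at each belief an action that maximizes the long-term expected reward. -/
def IsMaximizing (γ : ℝ) (v : (U × OtherTypes Y i → ℝ) → ℝ)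
    (d : (U × OtherTypes Y i → ℝ) → A i) : Prop :=
  ∀ b ∈ stdSimplex ℝ (U × OtherTypes Y i), ∀ a : A i,
    G.actionValue γ v b a ≤ G.actionValue γ v b (d b)

/-- The belief after the given past, started from `b`. -/
def beliefAfter (b : U × OtherTypes Y i → ℝ) : List (Z × A i × O) → U × OtherTypes Y i → ℝ
  | [] => b
  | e :: h => G.beliefUpdate (beliefAfter b h) e.2.1 e.1 e.2.2

/-- The policy that starts from the belief `b`, updates it, and always takes the action that `d`
prescribes at the present belief. -/
def beliefPolicy (d : (U × OtherTypes Y i → ℝ) → A i) (b : U × OtherTypes Y i → ℝ) :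
    Policy A O Z i := fun h => PMF.pure (d (G.beliefAfter b h))

end Belief

end FogGame

end

/-
The likelihood ratio of other types with respect to the true types is a non-negative
supermartingale along a run, hence converges almost surely. The belief about types is the prior
reweighted by these ratios and normalized, and the ratio of the true types is constantly `1`, so
the normalizing sums stay away from zero and the beliefs converge. Where the limit of a ratio is not
zero, the successive factors of this ratio tend to `1`, so the limit belief is stationary.

The Bellman operator is a contraction with factor `γ` for the supremum distance. Given what node
`i` has seen, its belief is the conditional law of the physical state and the types, so the value
`V t` of a solution at the belief of slot `t` and the reward `R t` satisfy
`E (R t + γ * V (t + 1)) ≤ E (V t)`, with equality for a maximizing policy; multiplying by `γ ^ t`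
and summing over `t`, the values telescope and the discounted reward is compared with `V 0`.
-/

section Expect

variable {α β ι : Type*}

theorem summable_toReal_pmf (p : PMF α) : Summable fun x => (p x).toReal :=
  ENNReal.summable_toReal p.tsum_coe_ne_top

theorem tsum_toReal_pmf (p : PMF α) : ∑' x, (p x).toReal = 1 := by
  rw [← ENNReal.tsum_toReal_eq p.apply_ne_top, p.tsum_coe, ENNReal.toReal_one]

theorem toReal_pmf_mem_stdSimplex [Fintype α] (p : PMF α) :
    (fun x => (p x).toReal) ∈ stdSimplex ℝ α :=
  ⟨fun _ => ENNReal.toReal_nonneg, (tsum_fintype _).symm.trans (tsum_toReal_pmf p)⟩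

theorem summable_expect (p : PMF α) {f : α → ℝ} {C : ℝ} (hf : ∀ x, |f x| ≤ C) :
    Summable fun x => (p x).toReal * f x := by
  refine ((summable_toReal_pmf p).mul_right C).of_norm_bounded fun x => ?_
  rw [norm_mul, Real.norm_of_nonneg ENNReal.toReal_nonneg]
  exact mul_le_mul_of_nonneg_left (hf x) ENNReal.toReal_nonneg

theorem expect_fintype [Fintype α] (p : PMF α) (f : α → ℝ) :
    expect p f = ∑ x, (p x).toReal * f x := tsum_fintype _

theorem expect_const (p : PMF α) (c : ℝ) : expect p (fun _ => c) = c := by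
  rw [expect, tsum_mul_right, tsum_toReal_pmf, one_mul]

theorem expect_mono (p : PMF α) {f g : α → ℝ} {C D : ℝ} (hf : ∀ x, |f x| ≤ C)
    (hg : ∀ x, |g x| ≤ D) (h : ∀ x, f x ≤ g x) : expect p f ≤ expect p g :=
  (summable_expect p hf).tsum_le_tsum
    (fun x => mul_le_mul_of_nonneg_left (h x) ENNReal.toReal_nonneg) (summable_expect p hg)

theorem abs_expect_le (p : PMF α) {f : α → ℝ} {C : ℝ} (hf : ∀ x, |f x| ≤ C) :
    |expect p f| ≤ C := by
  have hle : expect p f ≤ expect p fun _ => C :=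
    expect_mono p hf (fun _ => le_refl |C|) fun x => (abs_le.1 (hf x)).2
  have hge : expect p (fun _ => -C) ≤ expect p f :=
    expect_mono p (fun _ => le_refl |(-C)|) hf fun x => (abs_le.1 (hf x)).1
  rw [expect_const] at hle hge
  exact abs_le.2 ⟨hge, hle⟩

theorem expect_add (p : PMF α) {f g : α → ℝ} {C D : ℝ} (hf : ∀ x, |f x| ≤ C)
    (hg : ∀ x, |g x| ≤ D) : expect p (fun x => f x + g x) = expect p f + expect p g := by
  simp only [expect, mul_add]
  exact (summable_expect p hf).tsum_add (summable_expect p hg)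

theorem expect_const_mul (p : PMF α) (c : ℝ) (f : α → ℝ) :
    expect p (fun x => c * f x) = c * expect p f := by
  simp only [expect, mul_left_comm _ c, tsum_mul_left]

theorem expect_sum_mul [Fintype ι] (p : PMF α) (b : ι → ℝ) {f : ι → α → ℝ} {C : ℝ}
    (hf : ∀ j x, |f j x| ≤ C) :
    expect p (fun x => ∑ j, b j * f j x) = ∑ j, b j * expect p (f j) := by
  simp only [expect, Finset.mul_sum, mul_left_comm _ (b _)]
  rw [Summable.tsum_finsetSum fun j _ => (summable_expect p (hf j)).mul_left (b j)]
  simp only [tsum_mul_left]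

theorem expect_pure (x : α) (f : α → ℝ) : expect (PMF.pure x) f = f x := by
  rw [expect, tsum_eq_single x fun y hy => by simp [PMF.pure_apply_of_ne _ _ hy]]
  simp

theorem summable_toReal_mul_toReal_pmf (p : PMF α) (k : α → PMF β) :
    Summable fun z : α × β => (p z.1).toReal * (k z.1 z.2).toReal := by
  refine (summable_prod_of_nonneg fun _ =>
    mul_nonneg ENNReal.toReal_nonneg ENNReal.toReal_nonneg).2
    ⟨fun x => (summable_toReal_pmf (k x)).mul_left (p x).toReal, ?_⟩
  simpa only [tsum_mul_left, tsum_toReal_pmf, mul_one] using summable_toReal_pmf p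

theorem toReal_bind_apply (p : PMF α) (k : α → PMF β) (y : β) :
    (p.bind k y).toReal = ∑' x, (p x).toReal * (k x y).toReal := by
  simp only [← ENNReal.toReal_mul]
  exact ENNReal.tsum_toReal_eq fun x => ENNReal.mul_ne_top (p.apply_ne_top x) ((k x).apply_ne_top y)

theorem expect_bind (p : PMF α) (k : α → PMF β) {f : β → ℝ} {C : ℝ} (hf : ∀ y, |f y| ≤ C) :
    expect (p.bind k) f = expect p fun x => expect (k x) f := by
  have hs : Summable (Function.uncurry fun x y => (p x).toReal * (k x y).toReal * f y) := by
    refine ((summable_toReal_mul_toReal_pmf p k).mul_right C).of_norm_bounded fun z => ?_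
    rw [Function.uncurry, norm_mul, Real.norm_of_nonneg (by positivity)]
    exact mul_le_mul_of_nonneg_left (hf z.2) (by positivity)
  simp only [expect, toReal_bind_apply, ← tsum_mul_right, ← tsum_mul_left, ← mul_assoc]
  exact hs.tsum_comm

theorem expect_map (p : PMF α) (g : α → β) {f : β → ℝ} {C : ℝ} (hf : ∀ y, |f y| ≤ C) :
    expect (p.map g) f = expect p fun x => f (g x) := by
  simp only [← PMF.bind_pure_comp, expect_bind p _ hf, Function.comp_apply, expect_pure]

end Expect

section Bayes

variable {ι : Type*} [Fintype ι] {w : ι → ℝ}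

/-- The probability vector proportional to the weights `w`. Bayes' rule normalizes the product of
likelihood and prior. If the weights sum to `0`, all entries are `0`. -/
noncomputable def normalizeWeights (w : ι → ℝ) (j : ι) : ℝ := w j / ∑ k, w k

theorem normalizeWeights_const_mul {c : ℝ} (hc : c ≠ 0) (w : ι → ℝ) :
    normalizeWeights (fun j => c * w j) = normalizeWeights w := by
  funext j
  rw [normalizeWeights, ← Finset.mul_sum, mul_div_mul_left _ _ hc, normalizeWeights]

theorem normalizeWeights_of_sum_eq_one (hw : ∑ j, w j = 1) : normalizeWeights w = w := by
  funext j
  rw [normalizeWeights, hw, div_one]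

theorem normalizeWeights_mem_stdSimplex (hw : ∀ j, 0 ≤ w j) (hw₀ : ∑ j, w j ≠ 0) :
    normalizeWeights w ∈ stdSimplex ℝ ι := by
  refine ⟨fun j => div_nonneg (hw j) (Finset.sum_nonneg fun k _ => hw k), ?_⟩
  simp only [normalizeWeights, ← Finset.sum_div, div_self hw₀]

theorem sum_mul_normalizeWeights (hw : ∀ j, 0 ≤ w j) (j : ι) :
    (∑ k, w k) * normalizeWeights w j = w j := by
  refine mul_div_cancel_of_imp' fun h => ?_
  exact (Finset.sum_eq_zero_iff_of_nonneg fun k _ => hw k).1 h j (Finset.mem_univ j)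

theorem normalizeWeights_mul_normalizeWeights (r : ι → ℝ) (hw₀ : ∑ j, w j ≠ 0) :
    normalizeWeights (fun j => r j * normalizeWeights w j) =
      normalizeWeights fun j => r j * w j := by
  rw [← normalizeWeights_const_mul (inv_ne_zero hw₀) fun j => r j * w j]
  congr 1
  funext j
  rw [normalizeWeights]
  ring

theorem tendsto_normalizeWeights {T : Type*} {f : Filter T} {v : T → ι → ℝ}
    (hw₀ : ∑ j, w j ≠ 0) (hv : Tendsto v f (𝓝 w)) :
    Tendsto (fun t => normalizeWeights (v t)) f (𝓝 (normalizeWeights w)) := by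
  rw [tendsto_pi_nhds] at hv ⊢
  exact fun j => (hv j).div (tendsto_finsetSum _ fun k _ => hv k) hw₀

theorem eq_normalizeWeights_of_succ {b L R : ℕ → ι → ℝ} {p : ι → ℝ} (hp : ∑ j, p j = 1)
    (hb₀ : b 0 = p) (hb : ∀ t, b (t + 1) = normalizeWeights fun j => R t j * b t j)
    (hL₀ : L 0 = 1) (hL : ∀ t, L (t + 1) = R t * L t) (hLp : ∀ t, ∑ j, L t j * p j ≠ 0) (t : ℕ) :
    b t = normalizeWeights fun j => L t j * p j := by
  induction t with
  | zero => simp only [hb₀, hL₀, Pi.one_apply, one_mul, normalizeWeights_of_sum_eq_one hp]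
  | succ t ih =>
    simp only [hb, ih, normalizeWeights_mul_normalizeWeights _ (hLp t), hL, Pi.mul_apply, mul_assoc]

theorem tendsto_mul_of_tendsto_of_succ {L R : ℕ → ℝ} {l : ℝ} (hL : ∀ t, L (t + 1) = R t * L t)
    (hl : Tendsto L atTop (𝓝 l)) : Tendsto (fun t => R t * l) atTop (𝓝 l) := by
  rcases eq_or_ne l 0 with rfl | hl₀
  · simp only [mul_zero, tendsto_const_nhds]
  · have hratio : Tendsto (fun t => L (t + 1) / L t * l) atTop (𝓝 l) := by
      simpa [div_self hl₀] using (((tendsto_add_atTop_iff_nat 1).2 hl).div hl hl₀).mul_const l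
    refine hratio.congr' ?_
    filter_upwards [hl.eventually_ne hl₀] with t ht
    rw [hL, mul_div_cancel_right₀ _ ht]

theorem tendsto_normalizeWeights_of_succ {b L R : ℕ → ι → ℝ} {p l : ι → ℝ} (hp : ∑ j, p j = 1)
    (hb₀ : b 0 = p) (hb : ∀ t, b (t + 1) = normalizeWeights fun j => R t j * b t j)
    (hL₀ : L 0 = 1) (hL : ∀ t, L (t + 1) = R t * L t) (hLp : ∀ t, ∑ j, L t j * p j ≠ 0)
    (hl : Tendsto L atTop (𝓝 l)) (hlp : ∑ j, l j * p j ≠ 0) :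
    Tendsto b atTop (𝓝 (normalizeWeights fun j => l j * p j)) ∧
      Tendsto (fun t => normalizeWeights fun j => R t j * normalizeWeights (fun k => l k * p k) j)
        atTop (𝓝 (normalizeWeights fun j => l j * p j)) := by
  constructor
  · rw [funext (eq_normalizeWeights_of_succ hp hb₀ hb hL₀ hL hLp)]
    exact tendsto_normalizeWeights hlp (tendsto_pi_nhds.2 fun j => (hl.apply_nhds j).mul_const _)
  · simp only [normalizeWeights_mul_normalizeWeights _ hlp, ← mul_assoc]
    refine tendsto_normalizeWeights hlp (tendsto_pi_nhds.2 fun j => Tendsto.mul_const _ ?_)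
    exact tendsto_mul_of_tendsto_of_succ (fun t => congrFun (hL t) j) (hl.apply_nhds j)

theorem exists_tendsto_of_tendsto_likelihoodRatio {b K L : ℕ → ι → ℝ} {p l : ι → ℝ} {y : ι}
    (hKy : ∀ t, K t y ≠ 0) (hp : p ∈ stdSimplex ℝ ι) (hpy : p y ≠ 0)
    (hb₀ : b 0 = p) (hb : ∀ t, b (t + 1) = normalizeWeights fun j => K t j * b t j)
    (hL₀ : L 0 = 1) (hL : ∀ t j, L (t + 1) j = K t j / K t y * L t j)
    (hLnonneg : ∀ t j, 0 ≤ L t j) (hl : Tendsto L atTop (𝓝 l)) :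
    ∃ q ∈ stdSimplex ℝ ι, Tendsto b atTop (𝓝 q) ∧
      Tendsto (fun t => normalizeWeights fun j => K t j * q j) atTop (𝓝 q) := by
  have hLy : ∀ t, L t y = 1 := fun t => by
    induction t with
    | zero => rw [hL₀, Pi.one_apply]
    | succ t ih => rw [hL, ih, div_self (hKy t), one_mul]
  have hlnonneg : ∀ j, 0 ≤ l j := fun j => ge_of_tendsto' (hl.apply_nhds j) (hLnonneg · j)
  have hly : l y = 1 := tendsto_nhds_unique (hl.apply_nhds y) (by simp [hLy])
  have hsum : ∀ M : ι → ℝ, (∀ j, 0 ≤ M j) → M y = 1 → ∑ j, M j * p j ≠ 0 := fun M hM hMy h =>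
    hpy <| by
      simpa [hMy] using (Finset.sum_eq_zero_iff_of_nonneg fun j _ => mul_nonneg (hM j) (hp.1 j)).1
        h y (Finset.mem_univ y)
  have hscale : ∀ t (v : ι → ℝ), normalizeWeights (fun j => K t j * v j) =
      normalizeWeights fun j => K t j / K t y * v j := fun t v => by
    rw [← normalizeWeights_const_mul (inv_ne_zero (hKy t))]
    simp only [div_eq_inv_mul, mul_assoc]
  have hlp := hsum l hlnonneg hly
  refine ⟨normalizeWeights fun j => l j * p j,
    normalizeWeights_mem_stdSimplex (fun j => mul_nonneg (hlnonneg j) (hp.1 j)) hlp, ?_⟩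
  simp only [hscale] at hb ⊢
  exact tendsto_normalizeWeights_of_succ hp.2 hb₀ hb hL₀ (fun t => funext (hL t))
    (fun t => hsum (L t) (hLnonneg t) (hLy t)) hl hlp

end Bayes

section DiscreteLaw

open scoped ENNReal NNReal

variable {S E : Type*} {mS : MeasurableSpace S} {P : Measure S}

/-- The random element `X` has the discrete law `p` under `P`. The space `E` carries no σ-algebra
and may be uncountable; only the level sets of `X` have to be measurable. -/
structure HasDiscreteLaw (X : S → E) (p : PMF E) (P : Measure S) : Prop where
  measurableSet_fiber : ∀ x, MeasurableSet (X ⁻¹' {x})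
  measure_fiber : ∀ x, P (X ⁻¹' {x}) = p x

namespace HasDiscreteLaw

variable {X : S → E} {p : PMF E}

theorem measurableSet_preimage (hX : HasDiscreteLaw X p P) {D : Set E} (hD : D.Countable) :
    MeasurableSet (X ⁻¹' D) := by
  rw [← Set.biUnion_preimage_singleton]
  exact .biUnion hD fun x _ => hX.measurableSet_fiber x

theorem measurable_comp (hX : HasDiscreteLaw X p P) {R : Type*} [Zero R] [MeasurableSpace R]
    {f : E → R} (hf : f.support.Countable) : Measurable fun ω => f (X ω) := by
  intro B _
  by_cases h₀ : (0 : R) ∈ B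
  · have hB : (f ⁻¹' B)ᶜ ⊆ f.support := fun x hx hfx => hx (by rwa [Set.mem_preimage, hfx])
    exact .of_compl (hX.measurableSet_preimage (hf.mono hB))
  · have hB : f ⁻¹' B ⊆ f.support := fun x hx hfx => h₀ (by rwa [Set.mem_preimage, hfx] at hx)
    exact hX.measurableSet_preimage (hf.mono hB)

theorem setLIntegral_preimage_singleton (hX : HasDiscreteLaw X p P) (g : E → ℝ≥0∞) (x : E) :
    ∫⁻ ω in X ⁻¹' {x}, g (X ω) ∂P = p x * g x := by
  rw [setLIntegral_congr_fun (g := fun _ => g x) (hX.measurableSet_fiber x)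
    fun ω hω => congrArg g hω, setLIntegral_const, hX.measure_fiber, mul_comm]

theorem setLIntegral_preimage_support (hX : HasDiscreteLaw X p P) (g : E → ℝ≥0∞) :
    ∫⁻ ω in X ⁻¹' p.support, g (X ω) ∂P = ∑' x, p x * g x := by
  rw [← Set.biUnion_preimage_singleton, lintegral_biUnion p.support_countable
    (fun x _ => hX.measurableSet_fiber x)
    fun x _ y _ hxy => Disjoint.preimage X (Set.disjoint_singleton.2 hxy)]
  simp only [hX.setLIntegral_preimage_singleton]
  rw [tsum_subtype p.support fun x => p x * g x, Set.indicator_eq_self.2]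
  exact fun x hx => left_ne_zero_of_mul hx

variable [IsProbabilityMeasure P]

theorem ae_mem_support (hX : HasDiscreteLaw X p P) : ∀ᵐ ω ∂P, X ω ∈ p.support := by
  have hone : P (X ⁻¹' p.support) = 1 := by
    simpa [p.tsum_coe] using hX.setLIntegral_preimage_support 1
  exact (prob_compl_eq_zero_iff (hX.measurableSet_preimage p.support_countable)).2 hone

theorem lintegral_comp (hX : HasDiscreteLaw X p P) (g : E → ℝ≥0∞) :
    ∫⁻ ω, g (X ω) ∂P = ∑' x, p x * g x := by
  have hmem : ∀ᵐ ω ∂P, ω ∈ X ⁻¹' p.support := hX.ae_mem_support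
  rw [← hX.setLIntegral_preimage_support, Measure.restrict_eq_self_of_ae_mem hmem]

theorem setLIntegral_comp (hX : HasDiscreteLaw X p P) {B : Set E}
    (hB : MeasurableSet (X ⁻¹' B)) (g : E → ℝ≥0∞) :
    ∫⁻ ω in X ⁻¹' B, g (X ω) ∂P = ∑' x, p x * B.indicator g x := by
  rw [← lintegral_indicator hB, ← hX.lintegral_comp]
  rfl

end HasDiscreteLaw

theorem ae_exists_tendsto_of_setLIntegral_succ_le [IsFiniteMeasure P] {ℱ : Filtration ℕ mS}
    {Y : ℕ → S → ℝ≥0} (hY : ∀ t, Measurable[ℱ t] (Y t)) (hY₀ : ∫⁻ ω, Y 0 ω ∂P ≠ ⊤)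
    (hle : ∀ t s, MeasurableSet[ℱ t] s → ∫⁻ ω in s, Y (t + 1) ω ∂P ≤ ∫⁻ ω in s, Y t ω ∂P) :
    ∀ᵐ ω ∂P, ∃ l : ℝ, Tendsto (fun t => (Y t ω : ℝ)) atTop (𝓝 l) := by
  have hY' : ∀ t, Measurable (Y t) := fun t => (hY t).mono (ℱ.le t) le_rfl
  have hmono : ∀ t, ∫⁻ ω, Y t ω ∂P ≤ ∫⁻ ω, Y 0 ω ∂P := fun t => by
    induction t with
    | zero => exact le_rfl
    | succ t ih => exact le_trans (by simpa using hle t Set.univ .univ) ih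
  have hfin : ∀ t, ∫⁻ ω, Y t ω ∂P ≠ ⊤ := fun t => ne_top_of_le_ne_top hY₀ (hmono t)
  have hint : ∀ t, Integrable (fun ω => (Y t ω : ℝ)) P := fun t =>
    ⟨(hY' t).coe_nnreal_real.aestronglyMeasurable, by
      simpa [HasFiniteIntegral] using (hfin t).lt_top⟩
  have hsub : Supermartingale (fun t ω => (Y t ω : ℝ)) ℱ P := by
    refine supermartingale_of_setIntegral_succ_le
      (fun t => (hY t).coe_nnreal_real.stronglyMeasurable) hint fun t s hs => ?_
    have h := hle t s hs
    rwa [lintegral_coe_eq_integral _ (hint _).restrict,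
      lintegral_coe_eq_integral _ (hint _).restrict,
      ENNReal.ofReal_le_ofReal_iff (integral_nonneg fun _ => NNReal.coe_nonneg _)] at h
  have := hsub.neg.exists_ae_tendsto_of_bdd (R := (∫⁻ ω, Y 0 ω ∂P).toNNReal) fun t => by
    rw [ENNReal.coe_toNNReal hY₀, Pi.neg_apply, eLpNorm_neg, eLpNorm_one_eq_lintegral_enorm]
    simpa using hmono t
  filter_upwards [this] with ω ⟨l, hl⟩
  exact ⟨-l, by simpa using hl.neg⟩

variable {κ : E → PMF E} {previous : E → E}

theorem tsum_bind_mul {E' : Type*} (p : PMF E) (κ : E → PMF E') (f : E' → ℝ≥0∞) :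
    ∑' x', p.bind κ x' * f x' = ∑' x, p x * ∑' x', κ x x' * f x' := by
  simp only [PMF.bind_apply, ← ENNReal.tsum_mul_right, ← ENNReal.tsum_mul_left, mul_assoc]
  exact ENNReal.tsum_comm

theorem tsum_mul_toNNReal_div_le (p q : PMF E) :
    ∑' x, p x * ((q x / p x).toNNReal : ℝ≥0∞) ≤ 1 := by
  rw [← q.tsum_coe]
  refine ENNReal.tsum_le_tsum fun x => ?_
  exact (mul_le_mul_right ENNReal.coe_toNNReal_le_self _).trans ENNReal.mul_div_le

theorem tsum_pure_mul (x : E) (f : E → ℝ≥0∞) : ∑' y, PMF.pure x y * f y = f x := by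
  rw [tsum_eq_single x fun y hy => by rw [PMF.pure_apply_of_ne _ _ hy, zero_mul],
    PMF.pure_apply_self, one_mul]

theorem tsum_map_mul {E' : Type*} (p : PMF E) (g : E → E') (f : E' → ℝ≥0∞) :
    ∑' y, p.map g y * f y = ∑' x, p x * f (g x) := by
  simp only [← PMF.bind_pure_comp, tsum_bind_mul, Function.comp_apply, tsum_pure_mul]

theorem tsum_bind_mul_indicator_le (hκ : ∀ x, ∀ x' ∈ (κ x).support, previous x' = x) {p : PMF E}
    {f : E → ℝ≥0∞} (hf : ∀ x ∈ p.support, ∑' x', κ x x' * f x' ≤ f x) (B : Set E) :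
    ∑' x', p.bind κ x' * (previous ⁻¹' B).indicator f x' ≤ ∑' x, p x * B.indicator f x := by
  rw [tsum_bind_mul]
  refine ENNReal.tsum_le_tsum fun x => ?_
  rcases eq_or_ne (p x) 0 with hx | hx
  · rw [hx, zero_mul, zero_mul]
  by_cases hB : x ∈ B
  · rw [Set.indicator_of_mem hB]
    gcongr
    refine le_trans (ENNReal.tsum_le_tsum fun x' => ?_) (hf x hx)
    gcongr
    exact Set.indicator_le_self _ _ _
  · have hzero : ∀ x', κ x x' * (previous ⁻¹' B).indicator f x' = 0 := fun x' => by
      by_cases hx' : κ x x' = 0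
      · rw [hx', zero_mul]
      · have : x' ∉ previous ⁻¹' B := by rwa [Set.mem_preimage, hκ x x' hx']
        rw [Set.indicator_of_notMem this, mul_zero]
    simp [hzero]

/-- The events that are measurable and determined by the present value of `X`, for a process whose
present value determines the previous one. -/
def historyFiltration (X : ℕ → S → E) (hprevious : ∀ t ω, previous (X (t + 1) ω) = X t ω) :
    Filtration ℕ mS where
  seq t := MeasurableSpace.comap (X t) ⊤ ⊓ mS
  mono' := by
    refine monotone_nat_of_le_succ fun t => inf_le_inf_right _ ?_
    rintro - ⟨B, -, rfl⟩
    exact ⟨previous ⁻¹' B, trivial,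
      by simp only [← Set.preimage_comp, Function.comp_def, hprevious]⟩
  le' _ := inf_le_right

variable [IsProbabilityMeasure P] {X : ℕ → S → E} {p : ℕ → PMF E} {f : E → ℝ≥0}

theorem ae_exists_tendsto_of_superharmonic_of_measurable (hX : ∀ t, HasDiscreteLaw (X t) (p t) P)
    (hp : ∀ t, p (t + 1) = (p t).bind κ)
    (hprevious : ∀ t ω, previous (X (t + 1) ω) = X t ω)
    (hκ : ∀ x, ∀ x' ∈ (κ x).support, previous x' = x)
    (hmeas : ∀ t, Measurable fun ω => f (X t ω))
    (hf : ∀ t, ∀ x ∈ (p t).support, ∑' x', κ x x' * (f x' : ℝ≥0∞) ≤ f x)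
    (hf₀ : ∑' x, p 0 x * (f x : ℝ≥0∞) ≠ ⊤) :
    ∀ᵐ ω ∂P, ∃ l : ℝ, Tendsto (fun t => (f (X t ω) : ℝ)) atTop (𝓝 l) := by
  refine ae_exists_tendsto_of_setLIntegral_succ_le (ℱ := historyFiltration X hprevious)
    (fun t B hB => ?_) ?_ fun t s hs => ?_
  · exact MeasurableSpace.measurableSet_inf.2 ⟨⟨f ⁻¹' B, trivial, rfl⟩, hmeas t hB⟩
  · rwa [(hX 0).lintegral_comp fun x => (f x : ℝ≥0∞)]
  · obtain ⟨⟨B, -, rfl⟩, hB⟩ := MeasurableSpace.measurableSet_inf.1 hs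
    have hB' : X (t + 1) ⁻¹' (previous ⁻¹' B) = X t ⁻¹' B := by
      simp only [← Set.preimage_comp, Function.comp_def, hprevious]
    rw [(hX t).setLIntegral_comp hB fun x => (f x : ℝ≥0∞), ← hB',
      (hX (t + 1)).setLIntegral_comp (hB' ▸ hB) fun x => (f x : ℝ≥0∞), hp]
    exact tsum_bind_mul_indicator_le hκ (hf t) B

theorem ae_exists_tendsto_of_superharmonic (hX : ∀ t, HasDiscreteLaw (X t) (p t) P)
    (hp : ∀ t, p (t + 1) = (p t).bind κ)
    (hprevious : ∀ t ω, previous (X (t + 1) ω) = X t ω)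
    (hκ : ∀ x, ∀ x' ∈ (κ x).support, previous x' = x)
    (hf : ∀ x, ∑' x', κ x x' * (f x' : ℝ≥0∞) ≤ f x)
    (hf₀ : ∑' x, p 0 x * (f x : ℝ≥0∞) ≠ ⊤) :
    ∀ᵐ ω ∂P, ∃ l : ℝ, Tendsto (fun t => (f (X t ω) : ℝ)) atTop (𝓝 l) := by
  -- Truncating `f` to the values that `X` can take makes it measurable along `X`.
  set g := (⋃ t, (p t).support).indicator f
  have hgf : ∀ t, ∀ x ∈ (p t).support, g x = f x := fun t x hx =>
    Set.indicator_of_mem (Set.mem_iUnion_of_mem t hx) f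
  have hg_le : ∀ x, (g x : ℝ≥0∞) ≤ f x := fun x => by
    gcongr
    exact Set.indicator_le_self _ _ _
  have hlim : ∀ᵐ ω ∂P, ∃ l : ℝ, Tendsto (fun t => (g (X t ω) : ℝ)) atTop (𝓝 l) := by
    refine ae_exists_tendsto_of_superharmonic_of_measurable hX hp hprevious hκ
      (fun t => (hX t).measurable_comp ?_) (fun t x hx => ?_) ?_
    · exact (Set.countable_iUnion fun t => (p t).support_countable).mono
        Set.support_indicator_subset
    · rw [hgf t x hx]
      exact (ENNReal.tsum_le_tsum fun x' => mul_le_mul_right (hg_le x') _).trans (hf x)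
    · exact ne_top_of_le_ne_top hf₀ (ENNReal.tsum_le_tsum fun x => mul_le_mul_right (hg_le x) _)
  filter_upwards [hlim, ae_all_iff.2 fun t => (hX t).ae_mem_support] with ω hω hω_mem
  simpa only [hgf _ _ (hω_mem _)] using hω

end DiscreteLaw

namespace FogGame

variable {F : Type*} {Y A : F → Type*} {U O Z : Type*}

section RunPosition

variable {i : F} {S : Type*} {y : OtherTypes Y i} {u : ℕ → S → U} {a : ℕ → S → A i}
  {o : ℕ → S → O}

/-- Physical state, types of the others and past at the beginning of slot `t` of a run. -/
def runPosition (y : OtherTypes Y i) (u : ℕ → S → U) (a : ℕ → S → A i) (o : ℕ → S → O) (t : ℕ)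
    (ω : S) : (U × OtherTypes Y i) × List (U × A i × O) :=
  ((u t ω, y), past (fun s => u s ω) (fun s => a s ω) (fun s => o s ω) t)

theorem runPosition_preimage_singleton (t : ℕ) (w : U) (h : List (U × A i × O)) :
    runPosition y u a o t ⁻¹' {((w, y), h)} =
      {ω | u t ω = w ∧ past (fun s => u s ω) (fun s => a s ω) (fun s => o s ω) t = h} := by
  ext ω
  simp [runPosition]

theorem runPosition_preimage_singleton_of_ne {z : OtherTypes Y i} (hz : z ≠ y) (t : ℕ) (w : U)
    (h : List (U × A i × O)) : runPosition y u a o t ⁻¹' {((w, z), h)} = ∅ := by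
  ext ω
  simp [runPosition, hz.symm]

end RunPosition

variable [DecidableEq F]

section Run

open scoped ENNReal NNReal

variable (G : FogGame F Y A U O Z) (i : F) (β : Behaviour A U O i)

/-- Law of the triple (physical state, types of the others, past) one slot after it was `r`. -/
noncomputable def runStep (r : (U × OtherTypes Y i) × List (U × A i × O)) :
    PMF ((U × OtherTypes Y i) × List (U × A i × O)) :=
  (β r.2 r.1.1).bind fun a => (G.stateKernel i r.1.2 r.1.1 a).bind fun u' =>
    (G.observation i a u').map fun o => ((u', r.1.2), (r.1.1, a, o) :: r.2)

theorem exists_of_mem_support_runStep {r r' : (U × OtherTypes Y i) × List (U × A i × O)}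
    (h : r' ∈ (G.runStep i β r).support) :
    ∃ a u' o, G.stateKernel i r.1.2 r.1.1 a u' ≠ 0 ∧
      r' = ((u', r.1.2), (r.1.1, a, o) :: r.2) := by
  simp only [runStep, PMF.mem_support_bind_iff, PMF.mem_support_map_iff] at h
  obtain ⟨a, -, u', hu', o, -, rfl⟩ := h
  exact ⟨a, u', o, hu', rfl⟩

theorem types_eq_of_mem_support_runLaw {u₀ : U} {y : OtherTypes Y i} {t : ℕ}
    {r : (U × OtherTypes Y i) × List (U × A i × O)}
    (hr : r ∈ (G.runLaw i β (PMF.pure (u₀, y)) t).support) : r.1.2 = y := by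
  induction t generalizing r with
  | zero =>
    rw [runLaw, PMF.pure_map, PMF.mem_support_pure_iff] at hr
    rw [hr]
  | succ t ih =>
    obtain ⟨r₀, hr₀, hr⟩ := (PMF.mem_support_bind_iff _ _ _).1 hr
    obtain ⟨a, u', o, -, rfl⟩ := G.exists_of_mem_support_runStep i β hr
    exact (ih hr₀ : r₀.1.2 = y)

/-- The triple (physical state, types of the others, past) at the beginning of the preceding
slot. -/
def previousPosition :
    (U × OtherTypes Y i) × List (U × A i × O) → (U × OtherTypes Y i) × List (U × A i × O)
  | (s, []) => (s, [])
  | (s, e :: h) => ((e.1, s.2), h)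

theorem previousPosition_of_mem_support_runStep
    {r r' : (U × OtherTypes Y i) × List (U × A i × O)} (h : r' ∈ (G.runStep i β r).support) :
    previousPosition i r' = r := by
  obtain ⟨a, u', o, -, rfl⟩ := G.exists_of_mem_support_runStep i β h
  rfl

/-- Likelihood ratio of the types `y'` with respect to the types `y`, given the present physical
state and the past. -/
noncomputable def likelihoodRatio (y y' : OtherTypes Y i) : U → List (U × A i × O) → ℝ≥0
  | _, [] => 1
  | w, e :: h => (G.stateKernel i y' e.1 e.2.1 w / G.stateKernel i y e.1 e.2.1 w).toNNReal *
      likelihoodRatio y y' e.1 h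

theorem tsum_runStep_mul_likelihoodRatio_le (y' : OtherTypes Y i)
    (r : (U × OtherTypes Y i) × List (U × A i × O)) :
    ∑' r', G.runStep i β r r' * (G.likelihoodRatio i r'.1.2 y' r'.1.1 r'.2 : ℝ≥0∞) ≤
      G.likelihoodRatio i r.1.2 y' r.1.1 r.2 := by
  simp only [runStep, tsum_bind_mul, tsum_map_mul, likelihoodRatio, ENNReal.coe_mul,
    ENNReal.tsum_mul_right, PMF.tsum_coe, one_mul, ← mul_assoc]
  refine mul_le_of_le_one_left' ?_
  rw [← (β r.2 r.1.1).tsum_coe]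
  exact ENNReal.tsum_le_tsum fun a => mul_le_of_le_one_right' (tsum_mul_toNNReal_div_le _ _)

variable {G i β} {u₀ : U} {y : OtherTypes Y i} {S : Type*}
  {u : ℕ → S → U} {a : ℕ → S → A i} {o : ℕ → S → O}

namespace IsRun

variable [MeasurableSpace S] {P : Measure S}

theorem measurableSet_past_eq (hrun : G.IsRun i β u₀ y P u a o) (t : ℕ)
    (h : List (U × A i × O)) :
    MeasurableSet {ω | past (fun s => u s ω) (fun s => a s ω) (fun s => o s ω) t = h} := by
  induction t generalizing h with
  | zero => simp only [past, MeasurableSet.const]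
  | succ t ih =>
    rcases h with - | ⟨⟨w, c, x⟩, h⟩
    · simp only [past, reduceCtorEq, MeasurableSet.const]
    · have hw : MeasurableSet (u t ⁻¹' {w}) := hrun.measurable_state t trivial
      have hc : MeasurableSet (a t ⁻¹' {c}) := hrun.measurable_action t trivial
      have hx : MeasurableSet (o (t + 1) ⁻¹' {x}) := hrun.measurable_obs (t + 1) trivial
      simp only [past, List.cons.injEq, Prod.mk.injEq]
      exact (hw.inter (hc.inter hx)).inter (ih h)

theorem hasDiscreteLaw_runPosition (hrun : G.IsRun i β u₀ y P u a o) (t : ℕ) :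
    HasDiscreteLaw (runPosition y u a o t) (G.runLaw i β (PMF.pure (u₀, y)) t) P where
  measurableSet_fiber := fun ⟨⟨w, z⟩, h⟩ => by
    rcases eq_or_ne z y with rfl | hz
    · rw [runPosition_preimage_singleton]
      exact (hrun.measurable_state t (MeasurableSpace.measurableSet_top (s := {w}))).inter
        (hrun.measurableSet_past_eq t h)
    · rw [runPosition_preimage_singleton_of_ne hz]
      exact .empty
  measure_fiber := fun ⟨⟨w, z⟩, h⟩ => by
    rcases eq_or_ne z y with rfl | hz
    · rw [runPosition_preimage_singleton, hrun.law]
    · rw [runPosition_preimage_singleton_of_ne hz, measure_empty]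
      by_contra hne
      exact hz (G.types_eq_of_mem_support_runLaw i β (Ne.symm hne))

variable [IsProbabilityMeasure P]

theorem ae_stateKernel_ne_zero (hrun : G.IsRun i β u₀ y P u a o) :
    ∀ᵐ ω ∂P, ∀ t, G.stateKernel i y (u t ω) (a t ω) (u (t + 1) ω) ≠ 0 := by
  refine ae_all_iff.2 fun t => ?_
  filter_upwards [(hrun.hasDiscreteLaw_runPosition (t + 1)).ae_mem_support] with ω hω
  obtain ⟨r, hr, hstep⟩ := (PMF.mem_support_bind_iff _ _ _).1 hω
  obtain ⟨c, w, x, hne, heq⟩ := G.exists_of_mem_support_runStep i β hstep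
  simp only [runPosition, past, Prod.mk.injEq, List.cons.injEq] at heq
  obtain ⟨⟨rfl, rfl⟩, ⟨hu, rfl, -⟩, -⟩ := heq
  rwa [hu]

theorem ae_exists_tendsto_likelihoodRatio (hrun : G.IsRun i β u₀ y P u a o)
    (y' : OtherTypes Y i) :
    ∀ᵐ ω ∂P, ∃ l : ℝ, Tendsto (fun t => (G.likelihoodRatio i y y' (u t ω)
      (past (fun s => u s ω) (fun s => a s ω) (fun s => o s ω) t) : ℝ)) atTop (𝓝 l) := by
  refine ae_exists_tendsto_of_superharmonic (X := runPosition y u a o) (κ := G.runStep i β)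
    (f := fun r => G.likelihoodRatio i r.1.2 y' r.1.1 r.2) hrun.hasDiscreteLaw_runPosition
    (fun _ => rfl) (fun _ _ => rfl) (fun _ _ => G.previousPosition_of_mem_support_runStep i β)
    (G.tsum_runStep_mul_likelihoodRatio_le i β y') ?_
  simp [runLaw, PMF.pure_map, likelihoodRatio]

theorem ae_exists_tendsto_typeBeliefSeq [Fintype F] [∀ j, Fintype (Y j)]
    (hrun : G.IsRun i β u₀ y P u a o) (prior : PMF (OtherTypes Y i)) (hy : prior y ≠ 0) :
    ∀ᵐ ω ∂P, ∃ q ∈ stdSimplex ℝ (OtherTypes Y i),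
      Tendsto (G.typeBeliefSeq i (fun y' => (prior y').toReal) (fun t => u t ω) (fun t => a t ω))
        atTop (𝓝 q) ∧
      Tendsto (fun t => G.typeBeliefUpdate i q (u t ω) (a t ω) (u (t + 1) ω)) atTop (𝓝 q) := by
  filter_upwards [hrun.ae_stateKernel_ne_zero,
    ae_all_iff.2 hrun.ae_exists_tendsto_likelihoodRatio] with ω hpos hlim
  choose l hl using hlim
  exact exists_tendsto_of_tendsto_likelihoodRatio (y := y)
    (K := fun t y' => (G.stateKernel i y' (u t ω) (a t ω) (u (t + 1) ω)).toReal)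
    (L := fun t y' => G.likelihoodRatio i y y' (u t ω) _)
    (fun t => (ENNReal.toReal_pos (hpos t) (PMF.apply_ne_top _ _)).ne')
    (toReal_pmf_mem_stdSimplex prior) (ENNReal.toReal_pos hy (PMF.apply_ne_top _ _)).ne' rfl
    (fun _ => rfl) rfl (fun t y' => by
      simp [past, likelihoodRatio, ENNReal.coe_toNNReal_eq_toReal]) (fun _ _ => NNReal.coe_nonneg _)
    (tendsto_pi_nhds.2 hl)

end IsRun

end Run

theorem typeBeliefUpdate_eq_of_frequently [Fintype F] [∀ j, Fintype (Y j)]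
    (G : FogGame F Y A U O Z) {i : F} {q : OtherTypes Y i → ℝ} {u : ℕ → U} {a : ℕ → A i}
    (hq : Tendsto (fun t => G.typeBeliefUpdate i q (u t) (a t) (u (t + 1))) atTop (𝓝 q))
    {w w' : U} {c : A i} (h : ∃ᶠ t in atTop, u t = w ∧ a t = c ∧ u (t + 1) = w') :
    G.typeBeliefUpdate i q w c w' = q := by
  refine (isClosed_singleton.mem_of_frequently_of_tendsto (h.mono ?_) hq).symm
  rintro t ⟨rfl, rfl, rfl⟩
  rfl

end FogGame

theorem abs_sum_mul_le {ι : Type*} [Fintype ι] {b f : ι → ℝ} {C : ℝ} (hb : ∀ j, 0 ≤ b j)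
    (hf : ∀ j, b j ≠ 0 → |f j| ≤ C) : |∑ j, b j * f j| ≤ (∑ j, b j) * C := by
  rw [Finset.sum_mul]
  refine (Finset.abs_sum_le_sum_abs _ _).trans (Finset.sum_le_sum fun j _ => ?_)
  rw [abs_mul, abs_of_nonneg (hb j)]
  rcases eq_or_ne (b j) 0 with hj | hj
  · simp only [hj, zero_mul, le_refl]
  · exact mul_le_mul_of_nonneg_left (hf j hj) (hb j)

theorem abs_sub_le_of_isLUB_range {α : Type*} {f g : α → ℝ} {x y D : ℝ}
    (hx : IsLUB (Set.range f) x) (hy : IsLUB (Set.range g) y) (h : ∀ a, |f a - g a| ≤ D) :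
    |x - y| ≤ D := by
  refine abs_sub_le_iff.2 ⟨sub_le_iff_le_add.2 (hx.2 ?_), sub_le_iff_le_add.2 (hy.2 ?_)⟩
  · rintro _ ⟨a, rfl⟩
    linarith [(abs_le.1 (h a)).2, hy.1 ⟨a, rfl⟩]
  · rintro _ ⟨a, rfl⟩
    linarith [(abs_le.1 (h a)).1, hx.1 ⟨a, rfl⟩]

theorem abs_indicator_le {α : Type*} {s : Set α} {f : α → ℝ} {C : ℝ} (hf : ∀ x ∈ s, |f x| ≤ C)
    (x : α) : |s.indicator f x| ≤ max C 0 := by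
  by_cases hx : x ∈ s
  · rw [Set.indicator_of_mem hx]
    exact (hf x hx).trans (le_max_left C 0)
  · rw [Set.indicator_of_notMem hx, abs_zero]
    exact le_max_right C 0

theorem existsUnique_bounded_fixedPoint {X : Type*} {K : ℝ} (hK₀ : 0 ≤ K) (hK₁ : K < 1)
    {T : (X → ℝ) → X → ℝ} (hbdd : ∀ f C, (∀ x, |f x| ≤ C) → ∃ D, ∀ x, |T f x| ≤ D)
    (hT : ∀ f g C D E, (∀ x, |f x| ≤ C) → (∀ x, |g x| ≤ D) → (∀ x, |f x - g x| ≤ E) →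
      ∀ x, |T f x - T g x| ≤ K * E) :
    ∃! f : X → ℝ, (∃ C, ∀ x, |f x| ≤ C) ∧ T f = f := by
  let _ : TopologicalSpace X := ⊥
  have : DiscreteTopology X := ⟨rfl⟩
  choose D hD using fun f : BoundedContinuousFunction X ℝ => hbdd f ‖f‖ f.norm_coe_le_norm
  let Φ : BoundedContinuousFunction X ℝ → BoundedContinuousFunction X ℝ := fun f =>
    .ofNormedAddCommGroupDiscrete (T f) (D f) (hD f)
  have hΦ : ContractingWith ⟨K, hK₀⟩ Φ := by
    refine ⟨hK₁, LipschitzWith.of_dist_le_mul fun f g => ?_⟩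
    refine (BoundedContinuousFunction.dist_le (mul_nonneg hK₀ dist_nonneg)).2 fun x => ?_
    exact hT f g _ _ _ f.norm_coe_le_norm g.norm_coe_le_norm
      (BoundedContinuousFunction.dist_coe_le_dist (f := f) (g := g)) x
  refine ⟨hΦ.fixedPoint, ⟨⟨_, hΦ.fixedPoint.norm_coe_le_norm⟩,
    congrArg DFunLike.coe hΦ.fixedPoint_isFixedPt⟩, fun f ⟨⟨C, hC⟩, hf⟩ => ?_⟩
  have hfix : Φ (.ofNormedAddCommGroupDiscrete f C hC) = .ofNormedAddCommGroupDiscrete f C hC :=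
    DFunLike.coe_injective hf
  exact congrArg DFunLike.coe (hΦ.fixedPoint_unique hfix)

namespace FogGame

variable {F : Type*} [DecidableEq F] {Y A : F → Type*} {U O Z : Type*}

theorem abs_slotReward_le {G : FogGame F Y A U O Z} {i : F} {C : ℝ}
    (hreward : ∀ u a, |G.reward i u a| ≤ C) (y : OtherTypes Y i) (u : U) (a : A i) :
    |G.slotReward i y u a| ≤ C :=
  abs_expect_le _ fun _ => hreward _ _

section Belief

variable {i : F} {b : U × OtherTypes Y i → ℝ}

theorem stateBelief_mul_typeBelief [Fintype F] [∀ j, Fintype (Y j)] (hb : ∀ s, 0 ≤ b s) (u : U)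
    (y : OtherTypes Y i) : stateBelief b u * typeBelief b u y = b (u, y) :=
  sum_mul_normalizeWeights (w := fun y => b (u, y)) (fun _ => hb _) y

variable [Fintype U]

theorem jointProb_nonneg (G : FogGame F Y A U O Z) (hb : ∀ s, 0 ≤ b s) (a : A i) (z : Z) (o : O)
    (s : U × OtherTypes Y i) : 0 ≤ G.jointProb b a z o s := by
  classical
  exact mul_nonneg ENNReal.toReal_nonneg <| Finset.sum_nonneg fun u _ =>
    ite_nonneg (mul_nonneg ENNReal.toReal_nonneg (hb _)) le_rfl

theorem jointProb_of_disclosed {G : FogGame F Y A U O Z} {u : U}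
    (hu : ∀ w, G.outcome i w = G.outcome i u → w = u) (a : A i) (o : O)
    (s : U × OtherTypes Y i) :
    G.jointProb b a (G.outcome i u) o s = (G.observation i a s.1 o).toReal *
      ((G.stateKernel i s.2 u a s.1).toReal * b (u, s.2)) := by
  classical
  rw [jointProb, Finset.sum_eq_single_of_mem u (Finset.mem_univ u)
    fun w _ hw => if_neg fun hw' => hw (hu w hw'), if_pos rfl]

variable [Fintype F] [∀ j, Fintype (Y j)]

variable (G : FogGame F Y A U O Z)

theorem signalProb_nonneg (hb : ∀ s, 0 ≤ b s) (a : A i) (z : Z) (o : O) :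
    0 ≤ G.signalProb b a z o :=
  Finset.sum_nonneg fun s _ => G.jointProb_nonneg hb a z o s

theorem signalProb_mul_beliefUpdate (hb : ∀ s, 0 ≤ b s) (a : A i) (z : Z) (o : O)
    (s : U × OtherTypes Y i) :
    G.signalProb b a z o * G.beliefUpdate b a z o s = G.jointProb b a z o s :=
  sum_mul_normalizeWeights (G.jointProb_nonneg hb a z o) s

theorem beliefUpdate_mem_stdSimplex (hb : ∀ s, 0 ≤ b s) {a : A i} {z : Z} {o : O}
    (h : G.signalProb b a z o ≠ 0) : G.beliefUpdate b a z o ∈ stdSimplex ℝ _ :=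
  normalizeWeights_mem_stdSimplex (G.jointProb_nonneg hb a z o) h

theorem typeBelief_beliefUpdate (hb : ∀ s, 0 ≤ b s) (a : A i) (o : O) {u u' : U}
    (hu : ∀ w, G.outcome i w = G.outcome i u → w = u)
    (h : stateBelief (G.beliefUpdate b a (G.outcome i u) o) u' ≠ 0) :
    typeBelief (G.beliefUpdate b a (G.outcome i u) o) u' =
      G.typeBeliefUpdate i (typeBelief b u) u a u' := by
  set c := (G.observation i a u' o).toReal / G.signalProb b a (G.outcome i u) o
  have hupdate : (fun y => G.beliefUpdate b a (G.outcome i u) o (u', y)) =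
      fun y => c * ((G.stateKernel i y u a u').toReal * b (u, y)) := by
    funext y
    rw [beliefUpdate, jointProb_of_disclosed hu, mul_div_right_comm]
  have hmass : stateBelief (G.beliefUpdate b a (G.outcome i u) o) u' =
      c * ∑ y, (G.stateKernel i y u a u').toReal * b (u, y) := by
    rw [Finset.mul_sum]
    exact congrArg (fun w => ∑ y, w y) hupdate
  have hc : c ≠ 0 := fun hc => h (by rw [hmass, hc, zero_mul])
  have hu₀ : stateBelief b u ≠ 0 := fun h₀ => h <| by
    simp only [hmass, ← stateBelief_mul_typeBelief hb, h₀, zero_mul, mul_zero,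
      Finset.sum_const_zero]
  calc typeBelief (G.beliefUpdate b a (G.outcome i u) o) u'
      = normalizeWeights fun y => c * ((G.stateKernel i y u a u').toReal * b (u, y)) :=
        congrArg normalizeWeights hupdate
    _ = normalizeWeights fun y => (G.stateKernel i y u a u').toReal * b (u, y) :=
        normalizeWeights_const_mul hc _
    _ = G.typeBeliefUpdate i (typeBelief b u) u a u' :=
        (normalizeWeights_mul_normalizeWeights _ hu₀).symm

variable [Fintype O] [Fintype Z]

theorem sum_jointProb_mul (b : U × OtherTypes Y i → ℝ) (a : A i)
    (f : U × OtherTypes Y i → Z → O → ℝ) :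
    ∑ z, ∑ o, ∑ s, G.jointProb b a z o s * f s z o =
      ∑ s, b s * expect (G.stateKernel i s.2 s.1 a) fun u' =>
        expect (G.observation i a u') fun o => f (u', s.2) (G.outcome i s.1) o := by
  classical
  have houtcome : ∀ o s', ∑ z, G.jointProb b a z o s' * f s' z o =
      ∑ u, b (u, s'.2) * ((G.stateKernel i s'.2 u a s'.1).toReal *
        ((G.observation i a s'.1 o).toReal * f s' (G.outcome i u) o)) := fun o s' => by
    simp only [jointProb, Finset.mul_sum, Finset.sum_mul]
    rw [Finset.sum_comm]
    refine Finset.sum_congr rfl fun u _ => ?_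
    simp only [mul_ite, ite_mul, mul_zero, zero_mul, Finset.sum_ite_eq, Finset.mem_univ, if_true]
    ring
  calc ∑ z, ∑ o, ∑ s, G.jointProb b a z o s * f s z o
      = ∑ o, ∑ u', ∑ s : U × OtherTypes Y i, b s * ((G.stateKernel i s.2 s.1 a u').toReal *
          ((G.observation i a u' o).toReal * f (u', s.2) (G.outcome i s.1) o)) := by
        rw [← Finset.sum_comm_cycle]
        simp only [houtcome, Fintype.sum_prod_type]
        exact Finset.sum_congr rfl fun o _ => Finset.sum_congr rfl fun u' _ => Finset.sum_comm
    _ = _ := by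
        rw [Finset.sum_comm_cycle]
        refine Finset.sum_congr rfl fun s _ => ?_
        rw [Finset.sum_comm]
        simp only [expect_fintype, Finset.mul_sum]

theorem sum_signalProb (b : U × OtherTypes Y i → ℝ) (a : A i) :
    ∑ z, ∑ o, G.signalProb b a z o = ∑ s, b s := by
  simpa only [signalProb, mul_one, expect_const] using G.sum_jointProb_mul b a fun _ _ _ => 1

theorem abs_sum_signalProb_mul_le (hb : ∀ s, 0 ≤ b s) (a : A i)
    {w : (U × OtherTypes Y i → ℝ) → ℝ} {D : ℝ} (hw : ∀ b ∈ stdSimplex ℝ _, |w b| ≤ D) :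
    |∑ z, ∑ o, G.signalProb b a z o * w (G.beliefUpdate b a z o)| ≤ (∑ s, b s) * D := by
  simp only [← G.sum_signalProb b a, ← Fintype.sum_prod_type']
  exact abs_sum_mul_le (fun _ => G.signalProb_nonneg hb a _ _)
    fun _ h => hw _ (G.beliefUpdate_mem_stdSimplex hb h)

theorem actionValue_eq (hb : ∀ s, 0 ≤ b s) (γ : ℝ) (v : (U × OtherTypes Y i → ℝ) → ℝ) (a : A i) :
    G.actionValue γ v b a = ∑ s, b s * G.slotReward i s.2 s.1 a +
      γ * ∑ z, ∑ o, G.signalProb b a z o * v (G.beliefUpdate b a z o) := by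
  simp only [actionValue, stateBelief_mul_typeBelief hb, Fintype.sum_prod_type]

variable {G} {γ C D : ℝ} {v v' : (U × OtherTypes Y i → ℝ) → ℝ}

theorem abs_actionValue_le (hreward : ∀ u a, |G.reward i u a| ≤ C) (hb : ∀ s, 0 ≤ b s)
    (hv : ∀ b ∈ stdSimplex ℝ _, |v b| ≤ D) (a : A i) :
    |G.actionValue γ v b a| ≤ (∑ s, b s) * (C + |γ| * D) := by
  rw [G.actionValue_eq hb, mul_add, mul_left_comm]
  refine (abs_add_le _ _).trans (add_le_add ?_ ?_)
  · exact abs_sum_mul_le hb fun s _ => abs_slotReward_le hreward _ _ _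
  · rw [abs_mul]
    exact mul_le_mul_of_nonneg_left (G.abs_sum_signalProb_mul_le hb a hv) (abs_nonneg γ)

theorem abs_actionValue_sub_le (hb : ∀ s, 0 ≤ b s)
    (hv : ∀ b ∈ stdSimplex ℝ _, |v b - v' b| ≤ D) (a : A i) :
    |G.actionValue γ v b a - G.actionValue γ v' b a| ≤ |γ| * ((∑ s, b s) * D) := by
  have hdiff := G.abs_sum_signalProb_mul_le hb a hv
  simp only [mul_sub, Finset.sum_sub_distrib] at hdiff
  rw [actionValue, actionValue, add_sub_add_left_eq_sub, ← mul_sub, abs_mul]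
  exact mul_le_mul_of_nonneg_left hdiff (abs_nonneg γ)

theorem actionValue_congr (hb : ∀ s, 0 ≤ b s) (hv : Set.EqOn v v' (stdSimplex ℝ _)) (a : A i) :
    G.actionValue γ v b a = G.actionValue γ v' b a := by
  have hdiff := abs_actionValue_sub_le (G := G) (γ := γ) (v := v) (v' := v') (D := 0) hb
    (fun b hb => by rw [hv hb, sub_self, abs_zero]) a
  rwa [mul_zero, mul_zero, abs_nonpos_iff, sub_eq_zero] at hdiff

end Belief

section Bellman

variable [Fintype F] [∀ j, Fintype (Y j)] [Fintype U] [Fintype O] [Fintype Z] {i : F}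
  {G : FogGame F Y A U O Z} {γ C D : ℝ} {v v' : (U × OtherTypes Y i → ℝ) → ℝ}

theorem IsBellmanSolution.congr (hv : G.IsBellmanSolution γ v)
    (h : Set.EqOn v v' (stdSimplex ℝ _)) : G.IsBellmanSolution γ v' := by
  obtain ⟨⟨D, hD⟩, hlub⟩ := hv
  refine ⟨⟨D, fun b hb => h hb ▸ hD b hb⟩, fun b hb => ?_⟩
  simpa only [h hb, actionValue_congr hb.1 h] using hlub b hb

theorem IsBellmanSolution.exists_abs_indicator_le (hv : G.IsBellmanSolution γ v) :
    ∃ D, ∀ b, |(stdSimplex ℝ _).indicator v b| ≤ D :=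
  ⟨_, abs_indicator_le hv.1.choose_spec⟩

variable (G γ) in
/-- The Bellman operator: the right-hand side of the Bellman equation as a function of the
belief, extended by `0` to vectors that are not beliefs. -/
noncomputable def bellmanOperator (v : (U × OtherTypes Y i → ℝ) → ℝ) :
    (U × OtherTypes Y i → ℝ) → ℝ :=
  (stdSimplex ℝ _).indicator fun b => ⨆ a, G.actionValue γ v b a

theorem isLUB_bellmanOperator [Nonempty (A i)] (hreward : ∀ u a, |G.reward i u a| ≤ C)
    (hv : ∀ b ∈ stdSimplex ℝ _, |v b| ≤ D) {b : U × OtherTypes Y i → ℝ}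
    (hb : b ∈ stdSimplex ℝ _) :
    IsLUB (Set.range fun a => G.actionValue γ v b a) (G.bellmanOperator γ v b) := by
  rw [bellmanOperator, Set.indicator_of_mem hb]
  refine isLUB_ciSup ⟨(∑ s, b s) * (C + |γ| * D), ?_⟩
  rintro _ ⟨a, rfl⟩
  exact (abs_le.1 (abs_actionValue_le hreward hb.1 hv a)).2

theorem abs_bellmanOperator_le [Nonempty (A i)] (hreward : ∀ u a, |G.reward i u a| ≤ C)
    (hv : ∀ b, |v b| ≤ D) (b : U × OtherTypes Y i → ℝ) :
    |G.bellmanOperator γ v b| ≤ max (C + |γ| * D) 0 := by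
  refine abs_indicator_le (fun b hb => ?_) b
  have hlub := isLUB_bellmanOperator (γ := γ) hreward (fun b _ => hv b) hb
  rw [bellmanOperator, Set.indicator_of_mem hb] at hlub
  have hzero : IsLUB (Set.range fun _ : A i => (0 : ℝ)) 0 := by
    rw [Set.range_const]
    exact isLUB_singleton
  refine sub_zero (⨆ a, G.actionValue γ v b a) ▸ abs_sub_le_of_isLUB_range hlub hzero fun a => ?_
  simpa only [sub_zero, hb.2, one_mul] using abs_actionValue_le hreward hb.1 (fun b _ => hv b) a

theorem abs_bellmanOperator_sub_le [Nonempty (A i)] (hreward : ∀ u a, |G.reward i u a| ≤ C)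
    {D' E : ℝ} (hv : ∀ b, |v b| ≤ D) (hv' : ∀ b, |v' b| ≤ D') (h : ∀ b, |v b - v' b| ≤ E)
    (b : U × OtherTypes Y i → ℝ) :
    |G.bellmanOperator γ v b - G.bellmanOperator γ v' b| ≤ |γ| * E := by
  by_cases hb : b ∈ stdSimplex ℝ (U × OtherTypes Y i)
  · refine abs_sub_le_of_isLUB_range (isLUB_bellmanOperator hreward (fun b _ => hv b) hb)
      (isLUB_bellmanOperator hreward (fun b _ => hv' b) hb) fun a => ?_
    simpa only [hb.2, one_mul] using abs_actionValue_sub_le hb.1 (fun b _ => h b) a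
  · rw [bellmanOperator, bellmanOperator, Set.indicator_of_notMem hb, Set.indicator_of_notMem hb,
      sub_zero, abs_zero]
    exact mul_nonneg (abs_nonneg γ) ((abs_nonneg _).trans (h b))

theorem IsBellmanSolution.bellmanOperator_indicator [Nonempty (A i)]
    (hreward : ∀ u a, |G.reward i u a| ≤ C) (hv : G.IsBellmanSolution γ v) :
    G.bellmanOperator γ ((stdSimplex ℝ _).indicator v) = (stdSimplex ℝ _).indicator v := by
  have hv' := hv.congr (v' := (stdSimplex ℝ _).indicator v) Set.eqOn_indicator.symm
  funext b
  by_cases hb : b ∈ stdSimplex ℝ (U × OtherTypes Y i)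
  · exact (isLUB_bellmanOperator hreward hv'.1.choose_spec hb).unique (hv'.2 b hb)
  · rw [bellmanOperator, Set.indicator_of_notMem hb, Set.indicator_of_notMem hb]

theorem exists_isBellmanSolution_unique [Nonempty (A i)]
    (hreward : ∀ u a, |G.reward i u a| ≤ C) (hγ : |γ| < 1) :
    ∃ v : (U × OtherTypes Y i → ℝ) → ℝ, G.IsBellmanSolution γ v ∧
      ∀ v', G.IsBellmanSolution γ v' → Set.EqOn v' v (stdSimplex ℝ _) := by
  obtain ⟨v, ⟨⟨D, hD⟩, hfix⟩, huniq⟩ := existsUnique_bounded_fixedPoint (abs_nonneg γ) hγ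
    (T := G.bellmanOperator (i := i) γ)
    (fun _ _ hf => ⟨_, abs_bellmanOperator_le hreward hf⟩)
    (fun _ _ _ _ _ => abs_bellmanOperator_sub_le hreward)
  refine ⟨v, ⟨⟨D, fun b _ => hD b⟩, fun b hb => ?_⟩, fun v' hv' => ?_⟩
  · simpa only [hfix] using isLUB_bellmanOperator hreward (fun b _ => hD b) hb (γ := γ)
  · rw [← huniq _ ⟨hv'.exists_abs_indicator_le, hv'.bellmanOperator_indicator hreward⟩]
    exact Set.eqOn_indicator.symm

theorem exists_isMaximizing [Nonempty (A i)] [Finite (A i)] (G : FogGame F Y A U O Z) (γ : ℝ)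
    (v : (U × OtherTypes Y i → ℝ) → ℝ) :
    ∃ d : (U × OtherTypes Y i → ℝ) → A i, G.IsMaximizing γ v d := by
  choose d hd using fun b => Finite.exists_max (G.actionValue γ v b)
  exact ⟨d, fun b _ => hd b⟩

theorem IsBellmanSolution.apply_eq (hv : G.IsBellmanSolution γ v)
    {d : (U × OtherTypes Y i → ℝ) → A i} (hd : G.IsMaximizing γ v d)
    {b : U × OtherTypes Y i → ℝ} (hb : b ∈ stdSimplex ℝ _) :
    G.actionValue γ v b (d b) = v b := by
  refine IsLUB.unique ?_ (hv.2 b hb)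
  exact IsGreatest.isLUB ⟨⟨d b, rfl⟩, Set.forall_mem_range.2 (hd b hb)⟩

end Bellman

end FogGame

section Discounting

variable {γ C : ℝ} {r : ℕ → ℝ}

theorem summable_pow_mul_of_abs_le (hγ : |γ| < 1) (hr : ∀ t, |r t| ≤ C) :
    Summable fun t => γ ^ t * r t := by
  refine ((summable_geometric_of_abs_lt_one hγ).norm.mul_right C).of_norm_bounded fun t => ?_
  rw [norm_mul]
  exact mul_le_mul_of_nonneg_left (hr t) (norm_nonneg _)

theorem hasSum_pow_mul_sub_mul_succ (hγ : |γ| < 1) (hr : ∀ t, |r t| ≤ C) :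
    HasSum (fun t => γ ^ t * (r t - γ * r (t + 1))) (r 0) := by
  have hs := summable_pow_mul_of_abs_le hγ hr
  have htail := (hasSum_nat_add_iff' 1).2 hs.hasSum
  simpa [mul_sub, pow_succ, mul_assoc] using hs.hasSum.sub htail

end Discounting

namespace FogGame

variable {F : Type*} [DecidableEq F] {Y A : F → Type*} {U O Z : Type*} {i : F}

section Visible

/-- What node `i` sees of the past. -/
def visible (G : FogGame F Y A U O Z) (i : F) (h : List (U × A i × O)) : List (Z × A i × O) :=
  h.map fun e => (G.outcome i e.1, e.2.1, e.2.2)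

variable (G : FogGame F Y A U O Z) (π : Policy A O Z i) (init : PMF (U × OtherTypes Y i)) (t : ℕ)

/-- Law of what node `i` has seen at the beginning of slot `t` under a policy. -/
noncomputable def visibleLaw : PMF (List (Z × A i × O)) :=
  (G.runLaw i (π.behaviour G) init t).map fun r => G.visible i r.2

/-- Expectation, given the physical state and types `s` and what node `i` has seen, of a function
of these data one slot later. -/
noncomputable def nextExpect (f : U × OtherTypes Y i → List (Z × A i × O) → ℝ)
    (s : U × OtherTypes Y i) (k : List (Z × A i × O)) : ℝ :=
  expect (π k) fun a => expect (G.stateKernel i s.2 s.1 a) fun u' =>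
    expect (G.observation i a u') fun o => f (u', s.2) ((G.outcome i s.1, a, o) :: k)

variable {G π init t} {C : ℝ}

theorem expect_visibleLaw {g : List (Z × A i × O) → ℝ} (hg : ∀ k, |g k| ≤ C) :
    expect (G.visibleLaw π init t) g =
      expect (G.runLaw i (π.behaviour G) init t) fun r => g (G.visible i r.2) :=
  expect_map _ _ hg

theorem expect_runLaw_succ {f : U × OtherTypes Y i → List (Z × A i × O) → ℝ}
    (hf : ∀ s k, |f s k| ≤ C) :
    expect (G.runLaw i (π.behaviour G) init (t + 1)) (fun r => f r.1 (G.visible i r.2)) =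
      expect (G.runLaw i (π.behaviour G) init t)
        fun r => G.nextExpect π f r.1 (G.visible i r.2) := by
  have hf' : ∀ r : (U × OtherTypes Y i) × List (U × A i × O), |f r.1 (G.visible i r.2)| ≤ C :=
    fun _ => hf _ _
  simp only [runLaw, expect_bind _ _ hf', expect_map _ _ hf']
  rfl

theorem abs_nextExpect_le {f : U × OtherTypes Y i → List (Z × A i × O) → ℝ}
    (hf : ∀ s k, |f s k| ≤ C) (s : U × OtherTypes Y i) (k : List (Z × A i × O)) :
    |G.nextExpect π f s k| ≤ C :=
  abs_expect_le _ fun _ => abs_expect_le _ fun _ => abs_expect_le _ fun _ => hf _ _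

theorem meanReward_eq_expect_runLaw (hreward : ∀ u a, |G.reward i u a| ≤ C) :
    G.meanReward i π init t = expect (G.runLaw i (π.behaviour G) init t) fun r =>
      expect (π (G.visible i r.2)) fun a => G.slotReward i r.1.2 r.1.1 a := by
  have hx : ∀ x : U × ∀ j, A j, |G.reward i x.1 x.2| ≤ C := fun x => hreward x.1 x.2
  simp only [meanReward, expect_bind _ _ hx, expect_map _ _ hx]
  rfl

theorem abs_meanReward_le (hreward : ∀ u a, |G.reward i u a| ≤ C) :
    |G.meanReward i π init t| ≤ C :=
  abs_expect_le _ fun _ => hreward _ _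

end Visible

section Posterior

variable [Fintype F] [∀ j, Fintype (Y j)] [Fintype U] {G : FogGame F Y A U O Z}
  {b₀ : PMF (U × OtherTypes Y i)} {k : List (Z × A i × O)}

variable (G b₀) in
/-- The belief of node `i` after it has seen `k`, when the initial physical state and the types
are distributed according to `b₀`. It is `0` if `k` cannot occur. -/
noncomputable def posterior (k : List (Z × A i × O)) : U × OtherTypes Y i → ℝ :=
  G.beliefAfter (fun s => (b₀ s).toReal) k

theorem posterior_mem_stdSimplex_or_eq_zero :
    G.posterior b₀ k ∈ stdSimplex ℝ _ ∨ G.posterior b₀ k = 0 := by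
  induction k with
  | nil => exact Or.inl (toReal_pmf_mem_stdSimplex b₀)
  | cons e k ih =>
    have hnonneg : ∀ s, 0 ≤ G.posterior b₀ k s := by
      rcases ih with ih | ih
      · exact ih.1
      · simp only [ih, Pi.zero_apply, le_refl, implies_true]
    rcases eq_or_ne (G.signalProb (G.posterior b₀ k) e.2.1 e.1 e.2.2) 0 with h | h
    · exact Or.inr (funext fun s => div_eq_zero_iff.2 (Or.inr h))
    · exact Or.inl (G.beliefUpdate_mem_stdSimplex hnonneg h)

theorem posterior_nonneg (s : U × OtherTypes Y i) : 0 ≤ G.posterior b₀ k s := by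
  rcases posterior_mem_stdSimplex_or_eq_zero (G := G) (b₀ := b₀) (k := k) with h | h
  · exact h.1 s
  · rw [h, Pi.zero_apply]

theorem sum_posterior_mul_le (C : ℝ) : (∑ s, G.posterior b₀ k s) * C ≤ |C| := by
  rcases posterior_mem_stdSimplex_or_eq_zero (G := G) (b₀ := b₀) (k := k) with h | h
  · rw [h.2, one_mul]
    exact le_abs_self C
  · simp only [h, Pi.zero_apply, Finset.sum_const_zero, zero_mul, abs_nonneg]

theorem abs_sum_posterior_mul_le {f : U × OtherTypes Y i → ℝ} {C : ℝ} (hf : ∀ s, |f s| ≤ C) :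
    |∑ s, G.posterior b₀ k s * f s| ≤ |C| :=
  (abs_sum_mul_le posterior_nonneg fun s _ => hf s).trans (sum_posterior_mul_le C)

variable {π : Policy A O Z i} {t : ℕ} {C D γ : ℝ} {v : (U × OtherTypes Y i → ℝ) → ℝ}

theorem expect_visibleLaw_zero (hv : ∀ b, |v b| ≤ D) :
    expect (G.visibleLaw π b₀ 0) (fun k => v (G.posterior b₀ k)) = v fun s => (b₀ s).toReal := by
  rw [expect_visibleLaw fun _ => hv _, runLaw, expect_map _ _ fun _ => hv _]
  exact expect_const b₀ (v fun s => (b₀ s).toReal)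

theorem expect_visibleLaw_sum_posterior_mul_nextExpect [Fintype O] [Fintype Z]
    {f : U × OtherTypes Y i → List (Z × A i × O) → ℝ} (hf : ∀ s k, |f s k| ≤ C) :
    expect (G.visibleLaw π b₀ t) (fun k => ∑ s, G.posterior b₀ k s * G.nextExpect π f s k) =
      expect (G.visibleLaw π b₀ t) fun k => expect (π k) fun a =>
        ∑ z, ∑ o, ∑ s, G.jointProb (G.posterior b₀ k) a z o s * f s ((z, a, o) :: k) := by
  refine congrArg (expect _) (funext fun k => ?_)
  simp only [G.sum_jointProb_mul _ _ fun s z o => f s ((z, _, o) :: k), nextExpect]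
  exact (expect_sum_mul (π k) _ fun s a =>
    abs_expect_le _ fun _ => abs_expect_le _ fun _ => hf _ _).symm

/-- The posterior is the conditional law of the physical state and the types. -/
theorem expect_runLaw_eq_expect_visibleLaw [Finite O] [Finite Z]
    {f : U × OtherTypes Y i → List (Z × A i × O) → ℝ} (hf : ∀ s k, |f s k| ≤ C) :
    expect (G.runLaw i (π.behaviour G) b₀ t) (fun r => f r.1 (G.visible i r.2)) =
      expect (G.visibleLaw π b₀ t) fun k => ∑ s, G.posterior b₀ k s * f s k := by
  have hpost : ∀ {f : U × OtherTypes Y i → List (Z × A i × O) → ℝ} {C}, (∀ s k, |f s k| ≤ C) →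
      ∀ k, |∑ s, G.posterior b₀ k s * f s k| ≤ |C| :=
    fun hf k => abs_sum_posterior_mul_le fun s => hf s k
  have := Fintype.ofFinite O
  have := Fintype.ofFinite Z
  induction t generalizing f C with
  | zero =>
    have hf' : ∀ r : (U × OtherTypes Y i) × List (U × A i × O), |f r.1 (G.visible i r.2)| ≤ C :=
      fun _ => hf _ _
    rw [expect_visibleLaw (hpost hf), runLaw, expect_map _ _ hf',
      expect_map _ _ fun _ => hpost hf _, expect_fintype]
    exact (expect_const _ _).symm
  | succ t ih =>
    rw [expect_visibleLaw (hpost hf), expect_runLaw_succ hf,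
      expect_runLaw_succ (f := fun _ k => ∑ s, G.posterior b₀ k s * f s k) fun _ => hpost hf,
      ih (abs_nextExpect_le hf), ih (abs_nextExpect_le fun _ => hpost hf),
      expect_visibleLaw_sum_posterior_mul_nextExpect hf,
      expect_visibleLaw_sum_posterior_mul_nextExpect fun _ => hpost hf]
    refine congrArg (expect _) (funext fun k => congrArg (expect _) (funext fun a => ?_))
    refine Finset.sum_congr rfl fun z _ => Finset.sum_congr rfl fun o _ => ?_
    rw [← Finset.sum_mul, ← signalProb, Finset.mul_sum]
    refine Finset.sum_congr rfl fun s _ => ?_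
    rw [← G.signalProb_mul_beliefUpdate posterior_nonneg, mul_assoc]
    rfl

theorem meanReward_eq_expect_visibleLaw [Finite O] [Finite Z]
    (hreward : ∀ u a, |G.reward i u a| ≤ C) :
    G.meanReward i π b₀ t = expect (G.visibleLaw π b₀ t) fun k => expect (π k) fun a =>
      ∑ s, G.posterior b₀ k s * G.slotReward i s.2 s.1 a := by
  rw [meanReward_eq_expect_runLaw hreward, expect_runLaw_eq_expect_visibleLaw
    (f := fun s k => expect (π k) fun a => G.slotReward i s.2 s.1 a)
    fun s k => abs_expect_le _ fun a => abs_slotReward_le hreward _ _ _]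
  exact congrArg (expect _) (funext fun k =>
    (expect_sum_mul _ _ fun s a => abs_slotReward_le hreward _ _ _).symm)

variable [Fintype O] [Fintype Z]

theorem expect_visibleLaw_succ (hv : ∀ b, |v b| ≤ D) :
    expect (G.visibleLaw π b₀ (t + 1)) (fun k => v (G.posterior b₀ k)) =
      expect (G.visibleLaw π b₀ t) fun k => expect (π k) fun a =>
        ∑ z, ∑ o, G.signalProb (G.posterior b₀ k) a z o *
          v (G.beliefUpdate (G.posterior b₀ k) a z o) := by
  rw [expect_visibleLaw fun _ => hv _,
    expect_runLaw_succ (f := fun _ k => v (G.posterior b₀ k)) fun _ _ => hv _,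
    expect_runLaw_eq_expect_visibleLaw (abs_nextExpect_le fun _ _ => hv _),
    expect_visibleLaw_sum_posterior_mul_nextExpect fun _ _ => hv _]
  simp only [← Finset.sum_mul]
  rfl

theorem abs_actionValue_posterior_le (hreward : ∀ u a, |G.reward i u a| ≤ C)
    (hv : ∀ b, |v b| ≤ D) (k : List (Z × A i × O)) (a : A i) :
    |G.actionValue γ v (G.posterior b₀ k) a| ≤ |C + |γ| * D| :=
  (abs_actionValue_le hreward posterior_nonneg (fun b _ => hv b) a).trans (sum_posterior_mul_le _)

theorem meanReward_add_mul_expect_visibleLaw_succ (hreward : ∀ u a, |G.reward i u a| ≤ C)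
    (hv : ∀ b, |v b| ≤ D) :
    G.meanReward i π b₀ t + γ * expect (G.visibleLaw π b₀ (t + 1)) (fun k => v (G.posterior b₀ k)) =
      expect (G.visibleLaw π b₀ t) fun k =>
        expect (π k) fun a => G.actionValue γ v (G.posterior b₀ k) a := by
  have hslot : ∀ k a, |∑ s, G.posterior b₀ k s * G.slotReward i s.2 s.1 a| ≤ |C| := fun k a =>
    abs_sum_posterior_mul_le fun s => abs_slotReward_le hreward _ _ _
  have hfuture : ∀ k a, |γ * ∑ z, ∑ o, G.signalProb (G.posterior b₀ k) a z o *
      v (G.beliefUpdate (G.posterior b₀ k) a z o)| ≤ |γ| * |D| := fun k a => by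
    rw [abs_mul]
    exact mul_le_mul_of_nonneg_left ((G.abs_sum_signalProb_mul_le posterior_nonneg a
      fun b _ => hv b).trans (sum_posterior_mul_le D)) (abs_nonneg γ)
  rw [meanReward_eq_expect_visibleLaw hreward, expect_visibleLaw_succ hv]
  simp only [G.actionValue_eq posterior_nonneg, expect_add _ (hslot _) (hfuture _),
    ← expect_const_mul]
  exact (expect_add _ (fun k => abs_expect_le _ (hslot k))
    fun k => abs_expect_le _ (hfuture k)).symm

end Posterior

section Verification

variable [Fintype F] [∀ j, Fintype (Y j)] [Fintype U] [Fintype O] [Fintype Z]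
  {G : FogGame F Y A U O Z} {b₀ : PMF (U × OtherTypes Y i)} {π : Policy A O Z i} {C D γ : ℝ}
  {v : (U × OtherTypes Y i → ℝ) → ℝ}

theorem longTermReward_le_of_expect_actionValue_le (hreward : ∀ u a, |G.reward i u a| ≤ C)
    (hv : ∀ b, |v b| ≤ D) (hγ₀ : 0 ≤ γ) (hγ₁ : γ < 1)
    (h : ∀ k, expect (π k) (G.actionValue γ v (G.posterior b₀ k)) ≤ v (G.posterior b₀ k)) :
    G.longTermReward i γ π b₀ ≤ v fun s => (b₀ s).toReal := by
  have hγ : |γ| < 1 := by rwa [abs_of_nonneg hγ₀]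
  have hV := hasSum_pow_mul_sub_mul_succ hγ fun t =>
    abs_expect_le (G.visibleLaw π b₀ t) fun k => hv (G.posterior b₀ k)
  rw [expect_visibleLaw_zero hv] at hV
  refine hasSum_le (fun t => mul_le_mul_of_nonneg_left ?_ (pow_nonneg hγ₀ t))
    (summable_pow_mul_of_abs_le hγ fun t => abs_meanReward_le hreward).hasSum hV
  rw [le_sub_iff_add_le, meanReward_add_mul_expect_visibleLaw_succ hreward hv]
  exact expect_mono _
    (fun k => abs_expect_le _ (abs_actionValue_posterior_le hreward hv k)) (fun k => hv _) h

theorem longTermReward_eq_of_expect_actionValue_eq (hreward : ∀ u a, |G.reward i u a| ≤ C)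
    (hv : ∀ b, |v b| ≤ D) (hγ : |γ| < 1)
    (h : ∀ k, expect (π k) (G.actionValue γ v (G.posterior b₀ k)) = v (G.posterior b₀ k)) :
    G.longTermReward i γ π b₀ = v fun s => (b₀ s).toReal := by
  have hV := hasSum_pow_mul_sub_mul_succ hγ fun t =>
    abs_expect_le (G.visibleLaw π b₀ t) fun k => hv (G.posterior b₀ k)
  rw [expect_visibleLaw_zero hv] at hV
  rw [longTermReward, ← hV.tsum_eq]
  refine tsum_congr fun t => congrArg (γ ^ t * ·) ?_
  rw [eq_sub_iff_add_eq, meanReward_add_mul_expect_visibleLaw_succ hreward hv]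
  exact congrArg (expect _) (funext h)

theorem actionValue_zero (γ : ℝ) (v : (U × OtherTypes Y i → ℝ) → ℝ) (a : A i) :
    G.actionValue γ v 0 a = 0 := by
  simp [actionValue, stateBelief, signalProb, jointProb]

theorem IsBellmanSolution.actionValue_posterior_le (hv : G.IsBellmanSolution γ v)
    (k : List (Z × A i × O)) (a : A i) :
    G.actionValue γ ((stdSimplex ℝ _).indicator v) (G.posterior b₀ k) a ≤
      (stdSimplex ℝ _).indicator v (G.posterior b₀ k) := by
  rcases posterior_mem_stdSimplex_or_eq_zero (G := G) (b₀ := b₀) (k := k) with h | h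
  · exact ((hv.congr Set.eqOn_indicator.symm).2 _ h).1 ⟨a, rfl⟩
  · rw [h, actionValue_zero, Set.indicator_of_notMem fun h₀ => by simpa using h₀.2]

theorem IsBellmanSolution.actionValue_posterior_eq (hv : G.IsBellmanSolution γ v)
    {d : (U × OtherTypes Y i → ℝ) → A i} (hd : G.IsMaximizing γ v d) (k : List (Z × A i × O)) :
    G.actionValue γ ((stdSimplex ℝ _).indicator v) (G.posterior b₀ k) (d (G.posterior b₀ k)) =
      (stdSimplex ℝ _).indicator v (G.posterior b₀ k) := by
  rcases posterior_mem_stdSimplex_or_eq_zero (G := G) (b₀ := b₀) (k := k) with h | h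
  · rw [actionValue_congr h.1 Set.eqOn_indicator, hv.apply_eq hd h, Set.indicator_of_mem h]
  · rw [h, actionValue_zero, Set.indicator_of_notMem fun h₀ => by simpa using h₀.2]

theorem IsBellmanSolution.longTermReward_le (hreward : ∀ u a, |G.reward i u a| ≤ C)
    (hγ₀ : 0 ≤ γ) (hγ₁ : γ < 1) (hv : G.IsBellmanSolution γ v) (π : Policy A O Z i)
    (b₀ : PMF (U × OtherTypes Y i)) :
    G.longTermReward i γ π b₀ ≤ v fun s => (b₀ s).toReal := by
  obtain ⟨D, hD⟩ := hv.exists_abs_indicator_le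
  rw [← Set.indicator_of_mem (toReal_pmf_mem_stdSimplex b₀) v]
  refine longTermReward_le_of_expect_actionValue_le hreward hD hγ₀ hγ₁ fun k => ?_
  rw [← expect_const (π k) ((stdSimplex ℝ _).indicator v (G.posterior b₀ k))]
  exact expect_mono _ (abs_actionValue_posterior_le hreward hD k) (fun _ => hD _)
    (hv.actionValue_posterior_le k)

theorem IsBellmanSolution.longTermReward_beliefPolicy (hreward : ∀ u a, |G.reward i u a| ≤ C)
    (hγ : |γ| < 1) (hv : G.IsBellmanSolution γ v) {d : (U × OtherTypes Y i → ℝ) → A i}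
    (hd : G.IsMaximizing γ v d) (b₀ : PMF (U × OtherTypes Y i)) :
    G.longTermReward i γ (G.beliefPolicy d fun s => (b₀ s).toReal) b₀ =
      v fun s => (b₀ s).toReal := by
  obtain ⟨D, hD⟩ := hv.exists_abs_indicator_le
  rw [← Set.indicator_of_mem (toReal_pmf_mem_stdSimplex b₀) v]
  refine longTermReward_eq_of_expect_actionValue_eq hreward hD hγ fun k => ?_
  rw [beliefPolicy, expect_pure]
  exact hv.actionValue_posterior_eq hd k

end Verification

end FogGame

theorem theorem2 {F : Type*} [Fintype F] [DecidableEq F] {Y A : F → Type*} {U O Z : Type*}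
    [∀ j, Fintype (Y j)] [∀ j, Nonempty (A j)] [Fintype U] [Fintype O] [Fintype Z]
    (G : FogGame F Y A U O Z) (i : F)
    (hreward : ∃ C : ℝ, ∀ u a, |G.reward i u a| ≤ C)
    (γ : ℝ) (hγ₀ : 0 ≤ γ) (hγ₁ : γ < 1) :
    -- the belief about types converges to a stationary distribution
    (∀ (prior : PMF (OtherTypes Y i)) (y : OtherTypes Y i) (_ : prior y ≠ 0) (u₀ : U)
        (β : FogGame.Behaviour A U O i)
        {S : Type*} [MeasurableSpace S] (P : Measure S) [IsProbabilityMeasure P]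
        (u : ℕ → S → U) (a : ℕ → S → A i) (o : ℕ → S → O) (_ : G.IsRun i β u₀ y P u a o),
      ∀ᵐ ω ∂P, ∃ q ∈ stdSimplex ℝ (OtherTypes Y i),
        Tendsto (G.typeBeliefSeq i (fun y' => (prior y').toReal) (fun t => u t ω) (fun t => a t ω))
          atTop (𝓝 q) ∧
        Tendsto (fun t => G.typeBeliefUpdate i q (u t ω) (a t ω) (u (t + 1) ω)) atTop (𝓝 q) ∧
        ∀ w c w', (∃ᶠ t in atTop, u t ω = w ∧ a t ω = c ∧ u (t + 1) ω = w') →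
          G.typeBeliefUpdate i q w c w' = q) ∧
    -- this update is the type component of the belief update used by the policy, whenever the
    -- past physical state is disclosed
    (∀ b ∈ stdSimplex ℝ (U × OtherTypes Y i), ∀ (a : A i) (o : O) (u u' : U),
      (∀ w, G.outcome i w = G.outcome i u → w = u) →
      FogGame.stateBelief (G.beliefUpdate b a (G.outcome i u) o) u' ≠ 0 →
      FogGame.typeBelief (G.beliefUpdate b a (G.outcome i u) o) u' =
        G.typeBeliefUpdate i (FogGame.typeBelief b u) u a u') ∧
    -- the Bellman equation has one and only one bounded solution on the set of beliefs
    (∃ v : (U × OtherTypes Y i → ℝ) → ℝ, G.IsBellmanSolution γ v ∧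
      ∀ v' : (U × OtherTypes Y i → ℝ) → ℝ, G.IsBellmanSolution γ v' →
        Set.EqOn v' v (stdSimplex ℝ (U × OtherTypes Y i))) ∧
    -- the maximizing policy is optimal from every initial state of belief
    (∀ v : (U × OtherTypes Y i → ℝ) → ℝ, G.IsBellmanSolution γ v →
      (Finite (A i) → ∃ d : (U × OtherTypes Y i → ℝ) → A i, G.IsMaximizing γ v d) ∧
      ∀ d : (U × OtherTypes Y i → ℝ) → A i, G.IsMaximizing γ v d →
        ∀ b₀ : PMF (U × OtherTypes Y i),
          G.longTermReward i γ (G.beliefPolicy d fun s => (b₀ s).toReal) b₀ =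
            v (fun s => (b₀ s).toReal) ∧
          ∀ π : FogGame.Policy A O Z i,
            G.longTermReward i γ π b₀ ≤
              G.longTermReward i γ (G.beliefPolicy d fun s => (b₀ s).toReal) b₀) := by
  obtain ⟨C, hreward⟩ := hreward
  have hγ : |γ| < 1 := by rwa [abs_of_nonneg hγ₀]
  refine ⟨fun prior y hy u₀ β S _ P _ u a o hrun => ?_,
    fun b hb a o u u' hu h => G.typeBelief_beliefUpdate hb.1 a o hu h,
    FogGame.exists_isBellmanSolution_unique hreward hγ,
    fun v hv => ⟨fun _ => FogGame.exists_isMaximizing G γ v, fun d hd b₀ => ?_⟩⟩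
  · filter_upwards [hrun.ae_exists_tendsto_typeBeliefSeq prior hy] with ω ⟨q, hq, hlim, hupdate⟩
    exact ⟨q, hq, hlim, hupdate, fun _ _ _ => G.typeBeliefUpdate_eq_of_frequently hupdate⟩
  · have hvalue := hv.longTermReward_beliefPolicy hreward hγ hd b₀
    exact ⟨hvalue, fun π => hvalue ▸ hv.longTermReward_le hreward hγ₀ hγ₁ π b₀⟩
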